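/- Digraphs are finite, have no loops, and may have multiple arcs. For an integer $k\ge 1$, a digraph is $k$-arc-connected if for every ordered pair of distinct vertices $u,v$ it contains $k$ pairwise arc-disjoint directed $(u,v)$-paths (so a digraph with at most one vertex is $k$-arc-connected). A spanning subdigraph has all the vertices and a subset of the arcs. A digraph is $m$-partite if its vertex set can be partitioned into $m$ (possibly empty) sets none of which contains both ends of an arc; its chromatic number $\chi$ is the least such $m$. For integers $r\ge k+1\ge 2$, let $D_{k,r}$ be the digraph with vertices $v_{i,j}$, where $i\in\mathbb{Z}/r$ and $j\in\mathbb{Z}/(2k+1)$, and with the following arcs: for all $i,j$ one arc from $v_{i,j}$ to each of $v_{i,j+1},\dots,v_{i,j+k}$ (so that for each $i$ the vertices $v_{i,j}$ induce a copy of the rotative tournament $R_{2k+1}$), and for all $i$ one arc from $v_{i,0}$ to each of $v_{i+1,0},\dots,v_{i+k,0}$ (the $k$-th power of an $r$-cycle). **Theorem.** Let $k\ge 1$ be an integer. 1. Every $k$-arc-connected digraph has a spanning $k$-arc-connected $(2k+1)$-partite subdigraph. 2. For every integer $r\ge k+1$ the digraph $D_{k,r}$ is $k$-arc-connected, and every spanning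 $k$-arc-connected subdigraph $D'$ of $D_{k,r}$ satisfies $\chi(D')\ge 2k+1$. 3. Consequently the bound $2k+1$ is best possible: there are infinitely many (indeed, arbitrarily large) $k$-arc-connected digraphs with no spanning $k$-arc-connected $2k$-partite subdigraph. -/

import Mathlib

/-- A digraph on the vertex type `V` in which parallel arcs are allowed and loops are not.
The arcs are the elements of the type `A`; the arc `a` goes from `tail a` to `head a`. -/
structure MultiDigraph (V : Type*) (A : Type*) where
  tail : A → V
  head : A → V
  loopless : ∀ a, tail a ≠ head a

namespace MultiDigraph

/-- `D.IsWalk u v p`: the arcs in the list `p`, in this order, form a directed walk from `u`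
to `v`. -/
def IsWalk {V A : Type*} (D : MultiDigraph V A) : V → V → List A → Prop
  | u, v, [] => u = v
  | u, v, a :: p => D.tail a = u ∧ D.IsWalk (D.head a) v p

/-- `D.IsPath u v p`: the list of arcs `p` is a directed walk from `u` to `v` that visits no vertex
twice, that is, a `(u,v)`-path. -/
def IsPath {V A : Type*} (D : MultiDigraph V A) (u v : V) (p : List A) : Prop :=
  D.IsWalk u v p ∧ (u :: p.map D.head).Nodup

/-- There are `m` pairwise arc-disjoint `(u,v)`-paths, that is, `λ(u,v) ≥ m`. -/
def HasArcDisjointPaths {V A : Type*} (D : MultiDigraph V A) (u v : V) (m : ℕ) : Prop :=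
  ∃ P : Fin m → List A,
    (∀ i, D.IsPath u v (P i)) ∧ ∀ i j, i ≠ j → List.Disjoint (P i) (P j)

/-- `D` is `k`-arc-connected: `λ(u,v) ≥ k` for all pairs of distinct vertices `u`, `v`. -/
def ArcConnected {V A : Type*} (D : MultiDigraph V A) (k : ℕ) : Prop :=
  ∀ u v : V, u ≠ v → D.HasArcDisjointPaths u v k

/-- The spanning subdigraph of `D` with arc set `S`. -/
def spanningSub {V A : Type*} (D : MultiDigraph V A) (S : Set A) : MultiDigraph V S where
  tail a := D.tail a
  head a := D.head a
  loopless a := D.loopless a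

/-- `D` is `m`-partite: its vertices can be partitioned into `m` independent sets (some of which
may be empty), given here as the colour classes of a map to `Fin m`. -/
def IsPartite {V A : Type*} (D : MultiDigraph V A) (m : ℕ) : Prop :=
  ∃ c : V → Fin m, ∀ a : A, c (D.tail a) ≠ c (D.head a)

/-- The chromatic number of `D`: the least `m` such that `D` is `m`-partite
(on a finite vertex set, such an `m` exists). -/
noncomputable def chromaticNumber {V A : Type*} (D : MultiDigraph V A) : ℕ :=
  sInf {m : ℕ | D.IsPartite m}

/-- The `k`-th power of the directed `n`-cycle `0, 1, …, n-1, 0`, for `k < n`: there is one arc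
from `i` to each of `i+1, …, i+k` (modulo `n`). The arc `(i, t)` goes from `i` to `i + t + 1`. -/
def cyclePower (n k : ℕ) (h : k < n) : MultiDigraph (Fin n) (Fin n × Fin k) where
  tail e := e.1
  head e := ⟨(e.1 + e.2 + 1) % n, Nat.mod_lt _ (by omega)⟩
  loopless e := by
    obtain ⟨⟨i, hi⟩, ⟨t, ht⟩⟩ := e
    simp only [ne_eq, Fin.mk.injEq]
    intro hit
    rcases Nat.lt_or_ge (i + t + 1) n with hlt | hge
    · rw [Nat.mod_eq_of_lt hlt] at hit
      omega
    · rw [Nat.mod_eq_sub_mod hge, Nat.mod_eq_of_lt (by omega)] at hit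
      omega

/-- The rotative tournament `R_{2k+1}`: the out-neighbours of `j` are `j+1, …, j+k`
(modulo `2k+1`). -/
def rotativeTournament (k : ℕ) : MultiDigraph (Fin (2 * k + 1)) (Fin (2 * k + 1) × Fin k) :=
  cyclePower (2 * k + 1) k (by omega)

/-- The digraph `D_{k,r}`, for `r ≥ k + 1`: its vertices are the pairs `(i, j) = v_{i,j}`; its arcs
are those of `r` disjoint copies of the rotative tournament `R_{2k+1}` (the `i`-th copy on the
vertices `(i, j)`), together with those of the `k`-th power of the `r`-cycle through the
vertices `(i, 0)`. -/
def joinedRotative (k r : ℕ) (h : k + 1 ≤ r) :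
    MultiDigraph (Fin r × Fin (2 * k + 1))
      ((Fin r × (Fin (2 * k + 1) × Fin k)) ⊕ (Fin r × Fin k)) where
  tail
    | Sum.inl (i, e) => (i, (rotativeTournament k).tail e)
    | Sum.inr e => ((cyclePower r k h).tail e, 0)
  head
    | Sum.inl (i, e) => (i, (rotativeTournament k).head e)
    | Sum.inr e => ((cyclePower r k h).head e, 0)
  loopless
    | Sum.inl (_, e) => fun he => (rotativeTournament k).loopless e (congrArg Prod.snd he)
    | Sum.inr e => fun he => (cyclePower r k h).loopless e (congrArg Prod.fst he)

end MultiDigraph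

/-! Menger's theorem turns arc-connectivity into a lower bound `k` on every cut, so only arc
multiplicities matter and a digraph can be treated as a weight function `V → V → ℕ`.

Upper bound, by induction on the number of vertices. Delete arcs until the digraph is minimally
`k`-arc-connected. By Mader (`exists_balanced`) some vertex `v` then has in-degree and out-degree
exactly `k`. By Mader's splitting-off theorem (`exists_splitting`) the arcs at `v` can be replaced
by arcs `x → y`, each standing for a pair `x → v → y`, so that the other vertices remain
`k`-arc-connected. By induction this smaller digraph has a spanning `k`-arc-connected part with a
proper `(2k+1)`-colouring. Discard the split arcs and restore `v` with its `2k` arcs: every cut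
regains at `v` at least what it lost (`WConn.unsplit`), the old colouring stays proper, and the at
most `2k` neighbours of `v` leave it a free colour.

Lower bound. In `D_{k,r}` each vertex other than the `v_{i,0}` has in-degree and out-degree `k`, so
all its arcs are forced into any spanning `k`-arc-connected subdigraph. Every arc of a copy of
`R_{2k+1}` has such an end, so whole tournaments on `2k+1` vertices survive. -/

section

open Finset

/-! ### Walks, flows and the arc version of Menger's theorem. -/

namespace MultiDigraph

variable {V A : Type*}

theorem isWalk_append (D : MultiDigraph V A) {u x v : V} {p q : List A}
    (hp : D.IsWalk u x p) (hq : D.IsWalk x v q) : D.IsWalk u v (p ++ q) := by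
  induction p generalizing u with
  | nil => cases hp; exact hq
  | cons a p ih => exact ⟨hp.1, ih hp.2⟩

theorem IsPath.exists_suffix {D : MultiDigraph V A} {x u v : V} {q : List A}
    (hq : D.IsPath x v q) (hu : u ∈ x :: q.map D.head) : ∃ q', D.IsPath u v q' ∧ q' ⊆ q := by
  induction q generalizing x with
  | nil =>
    obtain rfl : u = x := by simpa using hu
    exact ⟨[], hq, List.Subset.refl _⟩
  | cons a q ih =>
    rcases List.mem_cons.1 hu with rfl | hu
    · exact ⟨_, hq, List.Subset.refl _⟩
    · obtain ⟨q', h1, h2⟩ := ih ⟨hq.1.2, (List.nodup_cons.1 hq.2).2⟩ hu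
      exact ⟨q', h1, fun b hb => List.mem_cons_of_mem _ (h2 hb)⟩

theorem IsWalk.exists_isPath {D : MultiDigraph V A} {u v : V} {p : List A}
    (hp : D.IsWalk u v p) : ∃ q, D.IsPath u v q ∧ q ⊆ p := by
  induction p generalizing u with
  | nil => exact ⟨[], ⟨hp, by simp⟩, List.Subset.refl _⟩
  | cons a p ih =>
    obtain ⟨q, h1, h2⟩ := ih hp.2
    have h2' : q ⊆ a :: p := fun b hb => List.mem_cons_of_mem _ (h2 hb)
    by_cases hu : u ∈ D.head a :: q.map D.head
    · obtain ⟨q', h3, h4⟩ := h1.exists_suffix hu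
      exact ⟨q', h3, fun b hb => h2' (h4 hb)⟩
    · exact ⟨a :: q, ⟨⟨hp.1, h1.1⟩, List.nodup_cons.2 ⟨hu, h1.2⟩⟩,
        List.cons_subset.2 ⟨List.mem_cons_self, h2'⟩⟩

theorem IsPath.nodup {D : MultiDigraph V A} {u v : V} {p : List A} (hp : D.IsPath u v p) :
    p.Nodup :=
  List.Nodup.of_map _ (List.nodup_cons.1 hp.2).2

/-- A walk from inside `X` to outside `X` uses an arc leaving `X`. -/
theorem IsWalk.exists_leaving {D : MultiDigraph V A} {u v : V} {p : List A} {X : Set V}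
    (hp : D.IsWalk u v p) (hu : u ∈ X) (hv : v ∉ X) :
    ∃ a ∈ p, D.tail a ∈ X ∧ D.head a ∉ X := by
  induction p generalizing u with
  | nil => cases hp; exact absurd hu hv
  | cons a p ih =>
    by_cases h : D.head a ∈ X
    · obtain ⟨b, hb, h'⟩ := ih hp.2 h
      exact ⟨b, List.mem_cons_of_mem _ hb, h'⟩
    · exact ⟨a, List.mem_cons_self, hp.1 ▸ hu, h⟩

/-- Either the arcs in `F` contain a `(u,v)`-path, or no arc of `F` leaves some set that
separates `v` from `u`. -/
theorem exists_isPath_or_closed (D : MultiDigraph V A) (F : Set A) (u v : V) :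
    (∃ p, D.IsPath u v p ∧ ∀ a ∈ p, a ∈ F) ∨
      ∃ X : Set V, u ∈ X ∧ v ∉ X ∧ ∀ a ∈ F, D.tail a ∈ X → D.head a ∈ X := by
  by_cases h : ∃ p, D.IsWalk u v p ∧ ∀ a ∈ p, a ∈ F
  · obtain ⟨p, hp, hF⟩ := h
    obtain ⟨q, hq, hqp⟩ := hp.exists_isPath
    exact Or.inl ⟨q, hq, fun a ha => hF a (hqp ha)⟩
  · refine Or.inr ⟨{x | ∃ p, D.IsWalk u x p ∧ ∀ a ∈ p, a ∈ F}, ⟨[], rfl, by simp⟩, h, ?_⟩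
    rintro a ha ⟨p, hp, hF⟩
    refine ⟨p ++ [a], D.isWalk_append hp ⟨rfl, rfl⟩, ?_⟩
    intro b hb
    rcases List.mem_append.1 hb with hb | hb
    · exact hF b hb
    · rw [List.mem_singleton.1 hb]; exact ha

open Classical in
/-- The contribution of the arc `a` to the net outflow of the vertex `x`. -/
noncomputable def arcNet (D : MultiDigraph V A) (x : V) (a : A) : ℤ :=
  (if D.tail a = x then 1 else 0) - (if D.head a = x then 1 else 0)

open Classical in
theorem IsWalk.sum_arcNet {D : MultiDigraph V A} {u v : V} {p : List A} (hp : D.IsWalk u v p)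
    (x : V) :
    (p.map (D.arcNet x)).sum = (if u = x then 1 else 0) - (if v = x then 1 else 0) := by
  induction p generalizing u with
  | nil => cases hp; simp
  | cons a p ih => rw [List.map_cons, List.sum_cons, ih hp.2, arcNet, hp.1]; ring

open Classical in
theorem IsPath.sum_arcNet {D : MultiDigraph V A} {u v : V} {p : List A} (hp : D.IsPath u v p)
    (x : V) :
    ∑ a ∈ p.toFinset, D.arcNet x a = (if u = x then 1 else 0) - (if v = x then 1 else 0) := by
  rw [List.sum_toFinset _ hp.nodup, hp.1.sum_arcNet]

open Classical in
/-- The set of arcs `F` carries an integral `(u,v)`-flow of value `m`. -/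
def IsFlow (D : MultiDigraph V A) (u v : V) (F : Finset A) (m : ℕ) : Prop :=
  ∀ x, ∑ a ∈ F, D.arcNet x a = m * ((if u = x then 1 else 0) - (if v = x then 1 else 0))

open Classical in
theorem IsFlow.sum_eq {D : MultiDigraph V A} [Fintype V] {u v : V} {F : Finset A} {m : ℕ}
    (hF : D.IsFlow u v F m) {X : Set V} (hu : u ∈ X) (hv : v ∉ X) :
    ∑ a ∈ F, ((if D.tail a ∈ X then 1 else 0) - (if D.head a ∈ X then 1 else 0) : ℤ) = m := by
  have h1 : ∑ x ∈ univ.filter (· ∈ X), ∑ a ∈ F, D.arcNet x a = m := by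
    rw [sum_congr rfl fun x _ => hF x, ← mul_sum, sum_sub_distrib]
    simp [hu, hv]
  rw [← h1, sum_comm]
  refine sum_congr rfl fun a _ => ?_
  simp [arcNet]

open Classical in
/-- The residual digraph: the arcs in `F` are reversed. -/
noncomputable def residual (D : MultiDigraph V A) (F : Finset A) : MultiDigraph V A where
  tail a := if a ∈ F then D.head a else D.tail a
  head a := if a ∈ F then D.tail a else D.head a
  loopless a := by
    split_ifs
    · exact (D.loopless a).symm
    · exact D.loopless a

open Classical in
-- An arc of `F` on the residual path is traversed backwards, so its flow is cancelled; an arc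
-- outside `F` gains flow. Hence the symmetric difference.
theorem IsFlow.augment {D : MultiDigraph V A} {u v : V} {F : Finset A} {m : ℕ}
    (hF : D.IsFlow u v F m) {p : List A} (hp : (D.residual F).IsPath u v p) :
    D.IsFlow u v (symmDiff F p.toFinset) (m + 1) := by
  intro x
  have h1 := hF x
  have h2 := hp.sum_arcNet x
  have h3 : ∑ a ∈ p.toFinset, (D.residual F).arcNet x a
      = ∑ a ∈ p.toFinset \ F, D.arcNet x a - ∑ a ∈ F ∩ p.toFinset, D.arcNet x a := by
    rw [← sum_sdiff (inter_subset_right : F ∩ p.toFinset ⊆ p.toFinset), sub_eq_add_neg,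
      ← sum_neg_distrib, sdiff_inter_self_right]
    congr 1
    · refine sum_congr rfl fun a ha => ?_
      simp [arcNet, residual, (mem_sdiff.1 ha).2]
    · refine sum_congr rfl fun a ha => ?_
      simp [arcNet, residual, (mem_inter.1 ha).1]
  have h4 : ∑ a ∈ symmDiff F p.toFinset, D.arcNet x a
      = ∑ a ∈ F \ p.toFinset, D.arcNet x a + ∑ a ∈ p.toFinset \ F, D.arcNet x a := by
    rw [symmDiff_def, sup_eq_union, sum_union disjoint_sdiff_sdiff]
  have h5 : ∑ a ∈ F, D.arcNet x a
      = ∑ a ∈ F \ p.toFinset, D.arcNet x a + ∑ a ∈ F ∩ p.toFinset, D.arcNet x a := by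
    rw [add_comm, sum_inter_add_sum_sdiff]
  push_cast
  linarith

open Classical in
theorem exists_isFlow [Fintype V] [Fintype A] (D : MultiDigraph V A) {u v : V} {k : ℕ}
    (h : ∀ X : Set V, u ∈ X → v ∉ X →
      k ≤ #{a : A | D.tail a ∈ X ∧ D.head a ∉ X}) :
    ∀ m ≤ k, ∃ F, D.IsFlow u v F m := by
  intro m
  induction m with
  | zero => exact fun _ => ⟨∅, fun x => by simp⟩
  | succ m ih =>
    intro hm
    obtain ⟨F, hF⟩ := ih (by omega)
    rcases (D.residual F).exists_isPath_or_closed Set.univ u v with ⟨p, hp, -⟩ | ⟨X, hu, hv, hX⟩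
    · exact ⟨_, hF.augment hp⟩
    · exfalso
      have h1 := hF.sum_eq hu hv
      -- Closure of `X` in the residual digraph means that `F` contains every arc leaving `X` and
      -- none entering it, so the net flow `m` out of `X` is its whole out-degree.
      have h2 : (#{a : A | D.tail a ∈ X ∧ D.head a ∉ X} : ℤ) = m := by
        rw [← h1, card_filter]
        push_cast
        rw [← sum_subset (subset_univ F)]
        · refine sum_congr rfl fun a ha => ?_
          have := hX a trivial
          simp only [residual, ha, if_true] at this
          by_cases h3 : D.tail a ∈ X <;> by_cases h4 : D.head a ∈ X <;> simp_all
        · intro a _ ha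
          have := hX a trivial
          simp only [residual, ha, if_false] at this
          by_cases h3 : D.tail a ∈ X <;> by_cases h4 : D.head a ∈ X <;> simp_all
      have := h X hu hv
      omega

open Classical in
theorem IsFlow.exists_paths {D : MultiDigraph V A} [Fintype V] {u v : V} {m : ℕ} {F : Finset A}
    (hF : D.IsFlow u v F m) :
    ∃ P : Fin m → List A, (∀ i, D.IsPath u v (P i) ∧ ∀ a ∈ P i, a ∈ F) ∧
      ∀ i j, i ≠ j → List.Disjoint (P i) (P j) := by
  induction m generalizing F with
  | zero => exact ⟨fun _ => [], fun i => i.elim0, fun i => i.elim0⟩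
  | succ m ih =>
    rcases D.exists_isPath_or_closed F u v with ⟨p, hp, hpF⟩ | ⟨X, hu, hv, hX⟩
    · have hF' : D.IsFlow u v (F \ p.toFinset) m := by
        intro x
        have hs : p.toFinset ⊆ F := fun a ha => hpF a (List.mem_toFinset.1 ha)
        have h1 := sum_sdiff (f := D.arcNet x) hs
        rw [hp.sum_arcNet, hF x] at h1
        push_cast at h1
        linarith
      obtain ⟨P, hP, hd⟩ := ih hF'
      have hdp : ∀ i, List.Disjoint p (P i) := fun i a hap hai =>
        (mem_sdiff.1 ((hP i).2 a hai)).2 (List.mem_toFinset.2 hap)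
      refine ⟨Fin.cons p P, ?_, ?_⟩
      · refine Fin.cases ⟨hp, hpF⟩ fun i => ?_
        exact ⟨(hP i).1, fun a ha => (mem_sdiff.1 ((hP i).2 a ha)).1⟩
      · refine Fin.cases (Fin.cases (fun h => absurd rfl h) fun j _ => hdp j) fun i => ?_
        refine Fin.cases (fun _ => (hdp i).symm) fun j hij => ?_
        exact hd i j fun h => hij (h ▸ rfl)
    · exfalso
      have h1 := hF.sum_eq hu hv
      have h2 : ∑ a ∈ F, ((if D.tail a ∈ X then 1 else 0) - (if D.head a ∈ X then 1 else 0) : ℤ)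
          ≤ 0 := by
        refine sum_nonpos fun a ha => ?_
        have := hX a ha
        split_ifs <;> simp_all
      push_cast at h1
      omega

open Classical in
/-- Menger's theorem for arc-disjoint paths. -/
theorem hasArcDisjointPaths_iff [Fintype V] [Fintype A] (D : MultiDigraph V A) {u v : V} {k : ℕ} :
    D.HasArcDisjointPaths u v k ↔
      ∀ X : Set V, u ∈ X → v ∉ X → k ≤ #{a : A | D.tail a ∈ X ∧ D.head a ∉ X} := by
  constructor
  · rintro ⟨P, hP, hd⟩ X hu hv
    choose f hf hf' using fun i => (hP i).1.exists_leaving hu hv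
    have hinj : Function.Injective f := by
      intro i j hij
      by_contra hne
      exact hd i j hne (hf i) (hij ▸ hf j)
    have := card_le_card_of_injOn (s := (univ : Finset (Fin k)))
      (t := univ.filter fun a : A => D.tail a ∈ X ∧ D.head a ∉ X) f
      (fun i _ => by simpa using hf' i) hinj.injOn
    simpa using this
  · intro h
    obtain ⟨F, hF⟩ := D.exists_isFlow h k le_rfl
    obtain ⟨P, hP, hd⟩ := hF.exists_paths
    exact ⟨P, fun i => (hP i).1, hd⟩

open Classical in
theorem arcConnected_iff [Fintype V] [Fintype A] (D : MultiDigraph V A) {k : ℕ} :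
    D.ArcConnected k ↔ ∀ X : Finset V, X.Nonempty → X ≠ univ →
      k ≤ #{a : A | D.tail a ∈ X ∧ D.head a ∉ X} := by
  constructor
  · rintro h X ⟨u, hu⟩ hX
    obtain ⟨v, hv⟩ : ∃ v, v ∉ X := by
      by_contra! hc
      exact hX (eq_univ_iff_forall.2 hc)
    have := D.hasArcDisjointPaths_iff.1 (h u v fun e => hv (e ▸ hu)) (X : Set V) hu hv
    simpa using this
  · intro h u v _
    refine D.hasArcDisjointPaths_iff.2 fun X hu hv => ?_
    have := h (univ.filter (· ∈ X)) ⟨u, by simpa using hu⟩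
      (fun e => hv (by simpa using (eq_univ_iff_forall.1 e) v))
    simpa using this

end MultiDigraph

/-! ### Weighted cuts and Mader's theorem on minimally `k`-arc-connected digraphs. -/

section Weights

variable {V : Type*} [DecidableEq V]

/-- The total weight of the pairs in `U × U` that leave `X`. -/
def wCut (w : V → V → ℕ) (U X : Finset V) : ℕ :=
  ∑ x ∈ U, ∑ y ∈ U, if x ∈ X ∧ y ∉ X then w x y else 0

/-- Every nonempty proper subset of `U` is left by total weight at least `k`. -/
def WConn (k : ℕ) (w : V → V → ℕ) (U : Finset V) : Prop :=
  ∀ X ⊆ U, X.Nonempty → X ≠ U → k ≤ wCut w U X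

/-- The in-degree of `X` is written `wCut w U (U \ X)` throughout; reversing all arcs exchanges it
with the out-degree. -/
theorem wCut_swap (w : V → V → ℕ) (U X : Finset V) :
    wCut (fun x y => w y x) U X = wCut w U (U \ X) := by
  unfold wCut
  rw [sum_comm]
  refine sum_congr rfl fun x hx => sum_congr rfl fun y hy => ?_
  simp only [mem_sdiff, hx, hy]
  congr 1
  simp [and_comm]

theorem wCut_add_single (w : V → V → ℕ) {U : Finset V} (X : Finset V) {x y : V} (hx : x ∈ U)
    (hy : y ∈ U) :
    wCut (fun p q => w p q + if p = x ∧ q = y then 1 else 0) U X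
      = wCut w U X + if x ∈ X ∧ y ∉ X then 1 else 0 := by
  have h : (if x ∈ X ∧ y ∉ X then 1 else 0 : ℕ)
      = ∑ p ∈ U, ∑ q ∈ U, if p = x then (if q = y then (if x ∈ X ∧ y ∉ X then 1 else 0) else 0)
          else 0 := by
    rw [sum_eq_single x, sum_eq_single y] <;> simp +contextual [hx, hy]
  rw [h]
  unfold wCut
  rw [← sum_add_distrib]
  refine sum_congr rfl fun p _ => ?_
  rw [← sum_add_distrib]
  refine sum_congr rfl fun q _ => ?_
  by_cases h1 : p = x <;> by_cases h2 : q = y <;> simp [h1, h2]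
  split_ifs <;> rfl

/-- Submodularity: the two sides differ by the weight between `X \ Y` and `Y \ X`. -/
theorem wCut_union_inter (w : V → V → ℕ) (U X Y : Finset V) :
    wCut w U (X ∪ Y) + wCut w U (X ∩ Y) ≤ wCut w U X + wCut w U Y := by
  unfold wCut
  simp only [← sum_add_distrib]
  refine sum_le_sum fun x _ => sum_le_sum fun y _ => ?_
  by_cases h1 : x ∈ X <;> by_cases h2 : x ∈ Y <;> by_cases h3 : y ∈ X <;>
    by_cases h4 : y ∈ Y <;> simp [h1, h2, h3, h4]

theorem sum_wCut_compl_singleton (w : V → V → ℕ) (U M : Finset V) :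
    ∑ v ∈ M, wCut w U (U \ {v}) = ∑ x ∈ U, ∑ y ∈ U, if y ∈ M ∧ x ≠ y then w x y else 0 := by
  unfold wCut
  rw [sum_comm]
  refine sum_congr rfl fun x hx => ?_
  rw [sum_comm]
  refine sum_congr rfl fun y hy => ?_
  by_cases hyM : y ∈ M
  · rw [sum_eq_single y] <;> simp +contextual [hx, hy, hyM, eq_comm]
  · simp only [hyM, false_and, if_false]
    refine sum_eq_zero fun v hv => ?_
    have : y ≠ v := fun e => hyM (e ▸ hv)
    simp [hy, this]

theorem sum_wCut_singleton (w : V → V → ℕ) (U M : Finset V) :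
    ∑ v ∈ M, wCut w U {v} = ∑ x ∈ U, ∑ y ∈ U, if x ∈ M ∧ x ≠ y then w x y else 0 := by
  unfold wCut
  rw [sum_comm]
  refine sum_congr rfl fun x hx => ?_
  rw [sum_comm]
  refine sum_congr rfl fun y hy => ?_
  by_cases hxM : x ∈ M
  · rw [sum_eq_single x] <;> simp +contextual [hxM, eq_comm]
  · simp only [hxM, false_and, if_false]
    refine sum_eq_zero fun v hv => ?_
    have : x ≠ v := fun e => hxM (e ▸ hv)
    simp [this]

theorem WConn.le_compl {k : ℕ} {w : V → V → ℕ} {U : Finset V} (h : WConn k w U) {X : Finset V}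
    (hX : X ⊆ U) (hne : X.Nonempty) (hU : X ≠ U) : k ≤ wCut w U (U \ X) := by
  refine h _ sdiff_subset ?_ ?_
  · rw [sdiff_nonempty]
    exact fun h => hU (hX.antisymm h)
  · intro e
    obtain ⟨x, hx⟩ := hne
    have := hX hx
    rw [← e] at this
    exact (mem_sdiff.1 this).2 hx

theorem WConn.swap {k : ℕ} {w : V → V → ℕ} {U : Finset V} (h : WConn k w U) :
    WConn k (fun x y => w y x) U := fun X hX hne hU => by
  rw [wCut_swap]
  exact h.le_compl hX hne hU

/-- The counting step: a set `M` of in-degree `k` such that each arc inside `M` has its head of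
in-degree `k` or its tail of out-degree `k` consists of vertices of in-degree `k`, if no
vertex has both degrees equal to `k`. -/
theorem subset_of_in_tight {k : ℕ} {w : V → V → ℕ} {U M : Finset V} (h : WConn k w U)
    (hU : ∀ v ∈ U, {v} ≠ U)
    (hdis : ∀ v ∈ U, ¬(wCut w U (U \ {v}) = k ∧ wCut w U {v} = k))
    (hM : M ⊆ U) (hMU : M ≠ U) (htight : wCut w U (U \ M) = k)
    (harc : ∀ x ∈ M, ∀ y ∈ M, x ≠ y → w x y ≠ 0 →
      wCut w U (U \ {y}) = k ∨ wCut w U {x} = k) :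
    ∀ v ∈ M, wCut w U (U \ {v}) = k := by
  set P := M.filter fun v => wCut w U (U \ {v}) = k with hP
  set Q := M.filter fun v => wCut w U {v} = k with hQ
  have hPM : P ⊆ M := filter_subset _ _
  have hQM : Q ⊆ M := filter_subset _ _
  have hQP : Q ⊆ M \ P := by
    intro v hv
    simp only [hP, hQ, mem_filter, mem_sdiff, not_and] at hv ⊢
    exact ⟨hv.1, fun _ e => hdis v (hM hv.1) ⟨e, hv.2⟩⟩
  have harc' : ∀ x ∈ M, ∀ y ∈ M, x ≠ y → y ∉ P → x ∉ Q → w x y = 0 := by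
    intro x hx y hy hxy hyP hxQ
    by_contra hw
    rcases harc x hx y hy hxy hw with h1 | h1
    · exact hyP (mem_filter.2 ⟨hy, h1⟩)
    · exact hxQ (mem_filter.2 ⟨hx, h1⟩)
  have sP : ∑ v ∈ P, wCut w U (U \ {v}) = k * #P := by
    rw [sum_congr rfl fun v hv => (mem_filter.1 hv).2]
    rw [sum_const, smul_eq_mul, mul_comm]
  have sQ : ∑ v ∈ Q, wCut w U {v} = k * #Q := by
    rw [sum_congr rfl fun v hv => (mem_filter.1 hv).2]
    rw [sum_const, smul_eq_mul, mul_comm]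
  have sM : k * #P + (k + 1) * #(M \ P) ≤ ∑ v ∈ M, wCut w U (U \ {v}) := by
    rw [← sum_sdiff hPM, sP, add_comm]
    refine Nat.add_le_add_right ?_ _
    rw [mul_comm, ← smul_eq_mul]
    refine card_nsmul_le_sum _ _ _ fun v hv => ?_
    have hv' := mem_sdiff.1 hv
    have h1 := h.le_compl (singleton_subset_iff.2 (hM hv'.1)) (singleton_nonempty v)
      (hU v (hM hv'.1))
    have h2 : wCut w U (U \ {v}) ≠ k := fun e => hv'.2 (mem_filter.2 ⟨hv'.1, e⟩)
    omega
  clear_value P Q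
  have hpt : ∀ x y, x ∈ M → y ∈ M → x ≠ y → y ∉ P → x ∉ Q → w x y = 0 :=
    fun x y hx hy => harc' x hx y hy
  -- An arc with head in `M` enters `M`, has its head in `P`, or has its tail in `Q`.
  have i0 : ∑ v ∈ M, wCut w U (U \ {v})
      ≤ wCut w U (U \ M) + ∑ v ∈ P, wCut w U (U \ {v}) + ∑ v ∈ Q, wCut w U {v} := by
    rw [sum_wCut_compl_singleton, sum_wCut_compl_singleton, sum_wCut_singleton]
    unfold wCut
    simp only [← sum_add_distrib]
    refine sum_le_sum fun x hx => sum_le_sum fun y hy => ?_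
    have a1 := hpt x y
    have a2 := @hPM y
    have a3 := @hQM x
    simp only [mem_sdiff, hx, hy, true_and, not_not]
    clear * - a1 a2 a3
    grind
  by_cases he : M \ P = ∅
  · intro v hv
    have hv' : v ∈ P := sdiff_eq_empty_iff_subset.1 he hv
    rw [hP] at hv'
    exact (mem_filter.1 hv').2
  exfalso
  have hpos : 0 < #(M \ P) := card_pos.2 (nonempty_iff_ne_empty.2 he)
  rw [htight, sP, sQ] at i0
  have hcard : #(M \ P) = #Q := by
    by_contra hc
    have h1 := card_le_card hQP
    have h2 : #Q + 1 ≤ #(M \ P) := by omega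
    have h3 : k * (#Q + 1) ≤ k * #(M \ P) := Nat.mul_le_mul_left _ h2
    nlinarith
  have hQe : Q = M \ P := eq_of_subset_of_card_le hQP hcard.le
  rw [hcard] at sM hpos
  -- With `Q = M \ P` the count can be sharpened by `k`, which is contradictory. If `P` is empty,
  -- compare the in-degree and out-degree sums over `M = Q`. Otherwise each arc entering `P` comes
  -- from outside `M` or from `Q`, so the right side of `i0` counts it twice.
  rcases P.eq_empty_or_nonempty with hPe | hPne
  · have i2 : ∑ v ∈ M, wCut w U (U \ {v}) + wCut w U M
        ≤ wCut w U (U \ M) + ∑ v ∈ Q, wCut w U {v} := by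
      rw [sum_wCut_compl_singleton, sum_wCut_singleton]
      unfold wCut
      simp only [← sum_add_distrib]
      refine sum_le_sum fun x hx => sum_le_sum fun y hy => ?_
      rw [hPe, sdiff_empty] at hQe
      subst hQe
      simp only [mem_sdiff, hx, hy, true_and, not_not]
      clear * -
      grind
    have hMne : M.Nonempty := (card_pos.1 hpos).mono hQM
    have := h M hM hMne hMU
    rw [htight, sQ] at i2
    nlinarith
  · have i1 : ∑ v ∈ M, wCut w U (U \ {v}) + wCut w U (U \ P)
        ≤ wCut w U (U \ M) + ∑ v ∈ P, wCut w U (U \ {v}) + ∑ v ∈ Q, wCut w U {v} := by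
      rw [sum_wCut_compl_singleton, sum_wCut_compl_singleton, sum_wCut_singleton]
      unfold wCut
      simp only [← sum_add_distrib]
      refine sum_le_sum fun x hx => sum_le_sum fun y hy => ?_
      have a1 := hpt x y
      have a2 := @hPM y
      have a3 : x ∈ Q ↔ x ∈ M ∧ x ∉ P := by rw [hQe, mem_sdiff]
      simp only [mem_sdiff, hx, hy, true_and, not_not]
      clear * - a1 a2 a3
      grind
    have := h.le_compl (hPM.trans hM) hPne (fun e => hMU (hM.antisymm (e ▸ hPM)))
    rw [htight, sP, sQ] at i1
    nlinarith

/-- A minimal set among those of in-degree `k` with a vertex of in-degree other than `k` and those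
of out-degree `k` with a vertex of out-degree other than `k` does not have in-degree `k`. -/
theorem not_in_tight_of_minimal {k : ℕ} {w : V → V → ℕ} {U M : Finset V} (h : WConn k w U)
    (hU : ∀ v ∈ U, {v} ≠ U)
    (hdis : ∀ v ∈ U, ¬(wCut w U (U \ {v}) = k ∧ wCut w U {v} = k))
    (hmin : ∀ x ∈ U, ∀ y ∈ U, x ≠ y → w x y ≠ 0 →
      ∃ Y ⊆ U, y ∈ Y ∧ x ∉ Y ∧ wCut w U (U \ Y) = k)
    (hM : M ⊆ U) (hMU : M ≠ U)
    (hin : ∀ X ⊂ M, X.Nonempty → wCut w U (U \ X) = k → ∀ v ∈ X, wCut w U (U \ {v}) = k)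
    (hout : ∀ X ⊂ M, X.Nonempty → wCut w U X = k → ∀ v ∈ X, wCut w U {v} = k)
    (htight : wCut w U (U \ M) = k) : ∀ v ∈ M, wCut w U (U \ {v}) = k := by
  refine subset_of_in_tight h hU hdis hM hMU htight fun x hx y hy hxy hw => ?_
  -- Uncross `M` with an in-tight set `Y` entered by the arc. If they cover `U`, the complement of
  -- `Y` is an out-tight proper subset of `M` containing `x`; if not, submodularity makes `M ∩ Y`
  -- in-tight, and it contains `y` but not `x`.
  obtain ⟨Y, hYU, hyY, hxY, hY⟩ := hmin x (hM hx) y (hM hy) hxy hw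
  by_cases hMY : M ∪ Y = U
  · right
    have hsub : U \ Y ⊂ M := by
      rw [ssubset_iff_of_subset]
      · exact ⟨y, hy, fun hc => (mem_sdiff.1 hc).2 hyY⟩
      · rw [← hMY, union_sdiff_right]
        exact sdiff_subset
    have hx' : x ∈ U \ Y := mem_sdiff.2 ⟨hM hx, hxY⟩
    exact hout _ hsub ⟨x, hx'⟩ hY x hx'
  · left
    have hsub : M ∩ Y ⊂ M := by
      rw [ssubset_iff_of_subset inter_subset_left]
      exact ⟨x, hx, fun hc => hxY (mem_inter.1 hc).2⟩
    have hy' : y ∈ M ∩ Y := mem_inter.2 ⟨hy, hyY⟩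
    refine hin _ hsub ⟨y, hy'⟩ ?_ y hy'
    have h1 := wCut_union_inter w U (U \ M) (U \ Y)
    rw [← sdiff_inter_distrib_right, ← sdiff_union_distrib, hY, htight] at h1
    have h2 := h.le_compl (hsub.1.trans hM) ⟨y, hy'⟩
      (fun e => hMU (hM.antisymm (e ▸ hsub.1)))
    have h3 := h.le_compl (union_subset hM hYU) ⟨y, mem_union_left _ hy⟩ hMY
    omega

/-- Mader's theorem: a minimally `k`-arc-connected digraph has a vertex of in-degree and
out-degree `k`. -/
theorem exists_balanced {k : ℕ} {w : V → V → ℕ} {U : Finset V} (hk : 1 ≤ k) (h : WConn k w U)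
    (hU2 : 2 ≤ #U)
    (hmin : ∀ x ∈ U, ∀ y ∈ U, x ≠ y → w x y ≠ 0 →
      ∃ Y ⊆ U, y ∈ Y ∧ x ∉ Y ∧ wCut w U (U \ Y) = k) :
    ∃ v ∈ U, wCut w U (U \ {v}) = k ∧ wCut w U {v} = k := by
  by_contra! hdis
  have hdis' : ∀ v ∈ U, ¬(wCut w U (U \ {v}) = k ∧ wCut w U {v} = k) :=
    fun v hv hc => hdis v hv hc.1 hc.2
  have hU : ∀ v ∈ U, {v} ≠ U := by
    rintro v - rfl
    simp at hU2
  let bad : Finset V → Prop := fun M => M ⊆ U ∧ M.Nonempty ∧ M ≠ U ∧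
    ((wCut w U (U \ M) = k ∧ ∃ v ∈ M, wCut w U (U \ {v}) ≠ k) ∨
      (wCut w U M = k ∧ ∃ v ∈ M, wCut w U {v} ≠ k))
  have hbad : ∃ M, bad M := by
    by_contra! hno
    -- With no bad set, every arc has a head of in-degree `k` and a tail of out-degree `k`. As `k ≥
    -- 1`, any vertex has both an entering and a leaving arc, hence both degrees equal to `k`.
    have key : ∀ x ∈ U, ∀ y ∈ U, x ≠ y → w x y ≠ 0 →
        wCut w U (U \ {y}) = k ∧ wCut w U {x} = k := by
      intro x hx y hy hxy hw
      obtain ⟨Y, hYU, hyY, hxY, hY⟩ := hmin x hx y hy hxy hw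
      have hYne : Y ≠ U := fun e => hxY (e ▸ hx)
      have h1 := hno Y
      have h2 := hno (U \ Y)
      have hx' : x ∈ U \ Y := mem_sdiff.2 ⟨hx, hxY⟩
      constructor
      · by_contra hc
        exact h1 ⟨hYU, ⟨y, hyY⟩, hYne, Or.inl ⟨hY, y, hyY, hc⟩⟩
      · by_contra hc
        refine h2 ⟨sdiff_subset, ⟨x, hx'⟩, fun e => ?_, Or.inr ⟨hY, x, hx', hc⟩⟩
        have := e ▸ hy
        exact (mem_sdiff.1 this).2 hyY
    obtain ⟨v, hv⟩ : U.Nonempty := card_pos.1 (by omega)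
    have hout : wCut w U {v} ≠ 0 := by
      have := h {v} (singleton_subset_iff.2 hv) (singleton_nonempty v) (hU v hv)
      omega
    have hin : wCut w U (U \ {v}) ≠ 0 := by
      have := h.le_compl (singleton_subset_iff.2 hv) (singleton_nonempty v) (hU v hv)
      omega
    unfold wCut at hout hin
    obtain ⟨x, hx, h1⟩ := exists_ne_zero_of_sum_ne_zero hout
    obtain ⟨y, hy, h2⟩ := exists_ne_zero_of_sum_ne_zero h1
    obtain ⟨x', hx', h3⟩ := exists_ne_zero_of_sum_ne_zero hin
    obtain ⟨y', hy', h4⟩ := exists_ne_zero_of_sum_ne_zero h3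
    simp only [mem_singleton, ne_eq, ite_eq_right_iff, Classical.not_imp, mem_sdiff, hx', hy',
      true_and, not_not] at h2 h4
    obtain ⟨⟨rfl, h5⟩, h6⟩ := h2
    obtain ⟨⟨h7, rfl⟩, h8⟩ := h4
    exact hdis' _ hv ⟨(key x' hx' _ hv h7 h8).1, (key _ hv y hy (Ne.symm h5) h6).2⟩
  obtain ⟨M, ⟨hM, hne, hMU, hcase⟩, hMmin⟩ :=
    WellFounded.has_min (wellFounded_lt (α := Finset V)) {M | bad M} hbad
  have hin : ∀ X ⊂ M, X.Nonempty → wCut w U (U \ X) = k →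
      ∀ v ∈ X, wCut w U (U \ {v}) = k := by
    intro X hX hXne ht v hv
    by_contra hc
    refine hMmin X ⟨hX.1.trans hM, hXne, ?_, Or.inl ⟨ht, v, hv, hc⟩⟩ hX
    rintro rfl
    exact hX.2 hM
  have hout : ∀ X ⊂ M, X.Nonempty → wCut w U X = k → ∀ v ∈ X, wCut w U {v} = k := by
    intro X hX hXne ht v hv
    by_contra hc
    refine hMmin X ⟨hX.1.trans hM, hXne, ?_, Or.inr ⟨ht, v, hv, hc⟩⟩ hX
    rintro rfl
    exact hX.2 hM
  rcases hcase with ⟨ht, v, hv, hc⟩ | ⟨ht, v, hv, hc⟩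
  · exact hc (not_in_tight_of_minimal h hU hdis' hmin hM hMU hin hout ht v hv)
  -- The out-tight case is the in-tight case of the reversed digraph.
  · have e : ∀ X ⊆ U, wCut (fun x y => w y x) U (U \ X) = wCut w U X := by
      intro X hX
      rw [wCut_swap, Finset.sdiff_sdiff_eq_self hX]
    have e1 : ∀ v ∈ U, wCut (fun x y => w y x) U (U \ {v}) = wCut w U {v} :=
      fun v hv => e _ (singleton_subset_iff.2 hv)
    refine hc ?_
    rw [← e1 v (hM hv)]
    refine not_in_tight_of_minimal h.swap hU ?_ ?_ hM hMU ?_ ?_ ?_ v hv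
    · exact fun v hv hc =>
        hdis' v hv ⟨by rw [← wCut_swap]; exact hc.2, by rw [← e1 v hv]; exact hc.1⟩
    · intro x hx y hy hxy hw
      obtain ⟨Y, hYU, hyY, hxY, hY⟩ := hmin y hy x hx hxy.symm hw
      refine ⟨U \ Y, sdiff_subset, mem_sdiff.2 ⟨hy, hxY⟩, fun hc => (mem_sdiff.1 hc).2 hyY, ?_⟩
      rw [Finset.sdiff_sdiff_eq_self hYU, wCut_swap, hY]
    · intro X hX hXne ht v hv
      rw [e _ (hX.1.trans hM)] at ht
      rw [e1 v (hM (hX.1 hv))]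
      exact hout X hX hXne ht v hv
    · intro X hX hXne ht v hv
      rw [wCut_swap] at ht ⊢
      exact hin X hX hXne ht v hv
    · rw [e M hM, ht]

end Weights

/-! ### Splitting off: `a x` arcs go from `x` to the special vertex, `b y` from it to `y`. -/

section Splitting

variable {V : Type*} [DecidableEq V]

/-- Two tight sets through a vertex `x` joined to the special vertex do not cover `U`, and their
union is tight. -/
theorem tight_union {k : ℕ} {w : V → V → ℕ} {U : Finset V} {a b : V → ℕ}
    (hab : ∑ x ∈ U, a x = ∑ x ∈ U, b x)
    (h1 : ∀ X ⊆ U, X.Nonempty → X ≠ U → k ≤ wCut w U X + ∑ x ∈ X, a x)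
    (h2 : ∀ X ⊆ U, X.Nonempty → X ≠ U → k ≤ wCut w U X + ∑ x ∈ U \ X, b x)
    {x : V} (hx : 0 < a x + b x) {X Y : Finset V} (hXU : X ⊆ U) (hYU : Y ⊆ U)
    (hxX : x ∈ X) (hxY : x ∈ Y) (hX : X ≠ U) (hY : Y ≠ U)
    (tX : wCut w U X + ∑ x ∈ X, a x = k) (tY : wCut w U Y + ∑ x ∈ Y, a x = k) :
    X ∪ Y ≠ U ∧ wCut w U (X ∪ Y) + ∑ x ∈ X ∪ Y, a x = k := by
  have hxi : x ∈ X ∩ Y := mem_inter.2 ⟨hxX, hxY⟩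
  have hu := sum_union_inter (s₁ := X) (s₂ := Y) (f := a)
  have hne : X ∪ Y ≠ U := by
    intro e
    -- If `X ∪ Y` were `U`, adding the two bounds would leave no arc between `X ∩ Y` and the special
    -- vertex, although `x` has one.
    have e1 := h2 X hXU ⟨x, hxX⟩ hX
    have e2 := h2 Y hYU ⟨x, hxY⟩ hY
    have e3 := sum_sdiff (f := b) hXU
    have e4 := sum_sdiff (f := b) hYU
    have e5 := sum_union_inter (s₁ := X) (s₂ := Y) (f := b)
    have e6 := single_le_sum (f := fun x => a x + b x) (fun _ _ => Nat.zero_le _) hxi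
    rw [sum_add_distrib] at e6
    rw [e] at hu e5
    omega
  refine ⟨hne, ?_⟩
  have e1 := h1 _ (union_subset hXU hYU) ⟨x, mem_union_left _ hxX⟩ hne
  have e2 := h1 _ (inter_subset_left.trans hXU) ⟨x, hxi⟩
    (fun e => hX (hXU.antisymm (e ▸ inter_subset_left)))
  have e3 := wCut_union_inter w U X Y
  omega

/-- Among the tight sets through `x` there is a largest one, if there is one at all. -/
theorem exists_max_tight {k : ℕ} {w : V → V → ℕ} {U : Finset V} {a b : V → ℕ}
    (hab : ∑ x ∈ U, a x = ∑ x ∈ U, b x)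
    (h1 : ∀ X ⊆ U, X.Nonempty → X ≠ U → k ≤ wCut w U X + ∑ x ∈ X, a x)
    (h2 : ∀ X ⊆ U, X.Nonempty → X ≠ U → k ≤ wCut w U X + ∑ x ∈ U \ X, b x)
    {x : V} (hx : 0 < a x + b x) :
    (∀ X ⊆ U, x ∈ X → X ≠ U → wCut w U X + ∑ x ∈ X, a x ≠ k) ∨
    ∃ X ⊆ U, x ∈ X ∧ X ≠ U ∧ wCut w U X + ∑ x ∈ X, a x = k ∧
      ∀ Y ⊆ U, x ∈ Y → Y ≠ U → wCut w U Y + ∑ x ∈ Y, a x = k → Y ⊆ X := by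
  by_cases h : ∀ X ⊆ U, x ∈ X → X ≠ U → wCut w U X + ∑ x ∈ X, a x ≠ k
  · exact Or.inl h
  push Not at h
  obtain ⟨X₀, hX₀⟩ := h
  let F := U.powerset.filter fun X => x ∈ X ∧ X ≠ U ∧ wCut w U X + ∑ x ∈ X, a x = k
  have hF : ∀ X, X ∈ F ↔ X ⊆ U ∧ x ∈ X ∧ X ≠ U ∧ wCut w U X + ∑ x ∈ X, a x = k := by
    intro X
    simp [F]
  obtain ⟨X, hX, hmax⟩ := exists_max_image F card ⟨X₀, (hF _).2 hX₀⟩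
  obtain ⟨hXU, hxX, hXne, tX⟩ := (hF _).1 hX
  refine Or.inr ⟨X, hXU, hxX, hXne, tX, fun Y hYU hxY hYne tY => ?_⟩
  obtain ⟨hne, tu⟩ := tight_union hab h1 h2 hx hXU hYU hxX hxY hXne hYne tX tY
  have := hmax _ ((hF _).2 ⟨union_subset hXU hYU, mem_union_left _ hxX, hne, tu⟩)
  rw [eq_of_subset_of_card_le subset_union_left this]
  exact subset_union_right

/-- There is a pair of an arc into and an arc out of the special vertex that can be split off. -/
theorem exists_splittable {k : ℕ} {w : V → V → ℕ} {U : Finset V} {a b : V → ℕ}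
    (hab : ∑ x ∈ U, a x = ∑ x ∈ U, b x) (hpos : 0 < ∑ x ∈ U, a x)
    (h1 : ∀ X ⊆ U, X.Nonempty → X ≠ U → k ≤ wCut w U X + ∑ x ∈ X, a x)
    (h2 : ∀ X ⊆ U, X.Nonempty → X ≠ U → k ≤ wCut w U (U \ X) + ∑ x ∈ X, b x) :
    ∃ x ∈ U, ∃ y ∈ U, 0 < a x ∧ 0 < b y ∧ ∀ X ⊆ U, x ∈ X → y ∈ X → X ≠ U →
      wCut w U X + ∑ x ∈ X, a x ≠ k ∧ wCut w U (U \ X) + ∑ x ∈ X, b x ≠ k := by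
  have hcompl : ∀ {X : Finset V}, X ⊆ U → X.Nonempty → X ≠ U →
      U \ X ⊆ U ∧ (U \ X).Nonempty ∧ U \ X ≠ U := by
    rintro X hX ⟨x, hx⟩ hne
    refine ⟨sdiff_subset, sdiff_nonempty.2 fun h => hne (hX.antisymm h), fun e => ?_⟩
    have := hX hx
    rw [← e] at this
    exact (mem_sdiff.1 this).2 hx
  have h1' : ∀ X ⊆ U, X.Nonempty → X ≠ U → k ≤ wCut w U (U \ X) + ∑ x ∈ U \ X, a x :=
    fun X hX hne hU => h1 _ (hcompl hX hne hU).1 (hcompl hX hne hU).2.1 (hcompl hX hne hU).2.2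
  have h2' : ∀ X ⊆ U, X.Nonempty → X ≠ U → k ≤ wCut w U X + ∑ x ∈ U \ X, b x := by
    intro X hX hne hU
    have := h2 _ (hcompl hX hne hU).1 (hcompl hX hne hU).2.1 (hcompl hX hne hU).2.2
    rwa [Finset.sdiff_sdiff_eq_self hX] at this
  -- Fix one in-neighbour `x` of the special vertex. Splitting `x` with `y` lowers only cuts of sets
  -- containing both, so failure for every `y` yields tight sets through `x` that cover all
  -- out-neighbours.
  obtain ⟨x, hx, hax⟩ := exists_ne_zero_of_sum_ne_zero hpos.ne'
  by_contra! hblock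
  have hblock' : ∀ y ∈ U, b y ≠ 0 →
      (∃ X ⊆ U, x ∈ X ∧ y ∈ X ∧ X ≠ U ∧ wCut w U X + ∑ x ∈ X, a x = k) ∨
      (∃ X ⊆ U, x ∈ X ∧ y ∈ X ∧ X ≠ U ∧ wCut w U (U \ X) + ∑ x ∈ X, b x = k) := by
    intro y hy hby
    obtain ⟨X, hX, hxX, hyX, hne, hc⟩ := hblock x hx y hy (by omega) (by omega)
    by_cases ht : wCut w U X + ∑ x ∈ X, a x = k
    · exact Or.inl ⟨X, hX, hxX, hyX, hne, ht⟩
    · exact Or.inr ⟨X, hX, hxX, hyX, hne, hc ht⟩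
  -- No single tight set through `x`, of either kind, contains all out-neighbours: comparing it with
  -- the opposite bound gives at least `a x` arcs from the special vertex to its complement.
  have c1 : ∀ X ⊆ U, x ∈ X → X ≠ U → wCut w U X + ∑ x ∈ X, a x = k →
      ∃ y ∈ U, b y ≠ 0 ∧ y ∉ X := by
    intro X hX hxX hne ht
    have e1 := h2' X hX ⟨x, hxX⟩ hne
    have e2 := single_le_sum (f := a) (fun _ _ => Nat.zero_le _) hxX
    obtain ⟨y, hy, hby⟩ := exists_ne_zero_of_sum_ne_zero
      (show ∑ x ∈ U \ X, b x ≠ 0 by omega)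
    exact ⟨y, (mem_sdiff.1 hy).1, hby, (mem_sdiff.1 hy).2⟩
  have c2 : ∀ X ⊆ U, x ∈ X → X ≠ U → wCut w U (U \ X) + ∑ x ∈ X, b x = k →
      ∃ y ∈ U, b y ≠ 0 ∧ y ∉ X := by
    intro X hX hxX hne ht
    have e1 := h1' X hX ⟨x, hxX⟩ hne
    have e2 := single_le_sum (f := a) (fun _ _ => Nat.zero_le _) hxX
    have e3 := sum_sdiff (f := a) hX
    have e4 := sum_sdiff (f := b) hX
    obtain ⟨y, hy, hby⟩ := exists_ne_zero_of_sum_ne_zero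
      (show ∑ x ∈ U \ X, b x ≠ 0 by omega)
    exact ⟨y, (mem_sdiff.1 hy).1, hby, (mem_sdiff.1 hy).2⟩
  have hX := exists_max_tight (x := x) hab h1 h2' (by omega)
  have hZ := exists_max_tight (x := x) (w := fun p q => w q p) (k := k) hab.symm
    (by simpa only [wCut_swap] using h2) (by simpa only [wCut_swap] using h1') (by omega)
  simp only [wCut_swap] at hZ
  obtain ⟨y₀, hy₀, hby₀⟩ := exists_ne_zero_of_sum_ne_zero (hab ▸ hpos).ne'
  rcases hX with hX | ⟨X, hXU, hxX, hXne, tX, maxX⟩ <;>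
    rcases hZ with hZ | ⟨Z, hZU, hxZ, hZne, tZ, maxZ⟩
  · rcases hblock' y₀ hy₀ hby₀ with ⟨X, q1, q2, -, q3, q4⟩ | ⟨X, q1, q2, -, q3, q4⟩
    · exact hX X q1 q2 q3 q4
    · exact hZ X q1 q2 q3 q4
  · obtain ⟨y, hy, hby, hyZ⟩ := c2 Z hZU hxZ hZne tZ
    rcases hblock' y hy hby with ⟨X, q1, q2, -, q3, q4⟩ | ⟨X, q1, q2, q5, q3, q4⟩
    · exact hX X q1 q2 q3 q4
    · exact hyZ (maxZ X q1 q2 q3 q4 q5)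
  · obtain ⟨y, hy, hby, hyX⟩ := c1 X hXU hxX hXne tX
    rcases hblock' y hy hby with ⟨X, q1, q2, q5, q3, q4⟩ | ⟨X, q1, q2, -, q3, q4⟩
    · exact hyX (maxX X q1 q2 q3 q4 q5)
    · exact hZ X q1 q2 q3 q4
  · have cover : ∀ y ∈ U, b y ≠ 0 → y ∈ X ∨ y ∈ Z := by
      intro y hy hby
      rcases hblock' y hy hby with ⟨Y, q1, q2, q5, q3, q4⟩ | ⟨Y, q1, q2, q5, q3, q4⟩
      · exact Or.inl (maxX Y q1 q2 q3 q4 q5)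
      · exact Or.inr (maxZ Y q1 q2 q3 q4 q5)
    have hXZ : (X \ Z).Nonempty := by
      obtain ⟨y, hy, hby, hyZ⟩ := c2 Z hZU hxZ hZne tZ
      exact ⟨y, mem_sdiff.2 ⟨(cover y hy hby).resolve_right hyZ, hyZ⟩⟩
    have hZX : (Z \ X).Nonempty := by
      obtain ⟨y, hy, hby, hyX⟩ := c1 X hXU hxX hXne tX
      exact ⟨y, mem_sdiff.2 ⟨(cover y hy hby).resolve_left hyX, hyX⟩⟩
    have e1 := h1 (X \ Z) (sdiff_subset.trans hXU) hXZ
      (fun e => (mem_sdiff.1 (e ▸ hx : x ∈ X \ Z)).2 hxZ)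
    have e2 := h2 (Z \ X) (sdiff_subset.trans hZU) hZX
      (fun e => (mem_sdiff.1 (e ▸ hx : x ∈ Z \ X)).2 hxX)
    -- Uncross the largest out-tight set `X` with the largest in-tight set `Z`: the bounds for `X \
    -- Z` and `Z \ X` force `a` to vanish on `X ∩ Z`, which contains `x`.
    have e3 := wCut_union_inter w U X (U \ Z)
    have e4 : X ∩ (U \ Z) = X \ Z := by
      ext p
      have := @hXU p
      simp only [mem_inter, mem_sdiff]
      tauto
    have e5 : X ∪ (U \ Z) = U \ (Z \ X) := by
      ext p
      have := @hXU p
      simp only [mem_union, mem_sdiff]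
      tauto
    rw [e4, e5] at e3
    have e6 := sum_inter_add_sum_sdiff X Z a
    have e7 := sum_le_sum_of_subset (f := b) (sdiff_subset : Z \ X ⊆ Z)
    have e8 := single_le_sum (f := a) (fun _ _ => Nat.zero_le _) (mem_inter.2 ⟨hxX, hxZ⟩)
    omega

/-- Mader's directed splitting-off theorem: all arcs at the special vertex can be split off. -/
theorem exists_splitting {k n : ℕ} {w : V → V → ℕ} {U : Finset V} {a b : V → ℕ}
    (ha : ∑ x ∈ U, a x = n) (hb : ∑ x ∈ U, b x = n)
    (h1 : ∀ X ⊆ U, X.Nonempty → X ≠ U → k ≤ wCut w U X + ∑ x ∈ X, a x)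
    (h2 : ∀ X ⊆ U, X.Nonempty → X ≠ U → k ≤ wCut w U (U \ X) + ∑ x ∈ X, b x) :
    ∃ s : V → V → ℕ, (∀ x ∈ U, ∑ y ∈ U, s x y ≤ a x) ∧ (∀ y ∈ U, ∑ x ∈ U, s x y ≤ b y) ∧
      WConn k (fun x y => w x y + s x y) U := by
  induction n generalizing w a b with
  | zero =>
    refine ⟨fun _ _ => 0, by simp, by simp, fun X hX hne hU => ?_⟩
    have e1 := h1 X hX hne hU
    have e2 := sum_le_sum_of_subset (f := a) hX
    have : ∑ x ∈ X, a x = 0 := by omega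
    simpa [this] using e1
  | succ n ih =>
    obtain ⟨x, hx, y, hy, hax, hby, hxy⟩ := exists_splittable (ha.trans hb.symm) (by omega) h1 h2
    let a' : V → ℕ := fun p => a p - if p = x then 1 else 0
    let b' : V → ℕ := fun p => b p - if p = y then 1 else 0
    have hsa : ∀ X : Finset V, ∑ p ∈ X, a p = ∑ p ∈ X, a' p + if x ∈ X then 1 else 0 := by
      intro X
      rw [← sum_ite_eq' X x (fun _ => 1), ← sum_add_distrib]
      refine sum_congr rfl fun p _ => ?_
      simp only [a']
      split_ifs with h
      · subst h; omega
      · rfl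
    have hsb : ∀ X : Finset V, ∑ p ∈ X, b p = ∑ p ∈ X, b' p + if y ∈ X then 1 else 0 := by
      intro X
      rw [← sum_ite_eq' X y (fun _ => 1), ← sum_add_distrib]
      refine sum_congr rfl fun p _ => ?_
      simp only [b']
      split_ifs with h
      · subst h; omega
      · rfl
    have ha' := hsa U
    have hb' := hsb U
    rw [if_pos hx] at ha'
    rw [if_pos hy] at hb'
    let w' : V → V → ℕ := fun p q => w p q + if p = x ∧ q = y then 1 else 0
    have h1' : ∀ X ⊆ U, X.Nonempty → X ≠ U → k ≤ wCut w' U X + ∑ x ∈ X, a' x := by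
      intro X hX hne hU
      have e1 := h1 X hX hne hU
      have e2 := hxy X hX
      have e3 := hsa X
      rw [wCut_add_single w X hx hy]
      by_cases m1 : x ∈ X <;> by_cases m2 : y ∈ X <;> simp [m1, m2] at e2 e3 ⊢
      · have := (e2 hU).1
        omega
      all_goals omega
    have h2' : ∀ X ⊆ U, X.Nonempty → X ≠ U → k ≤ wCut w' U (U \ X) + ∑ x ∈ X, b' x := by
      intro X hX hne hU
      have e1 := h2 X hX hne hU
      have e2 := hxy X hX
      have e3 := hsb X
      rw [wCut_add_single w _ hx hy]
      by_cases m1 : x ∈ X <;> by_cases m2 : y ∈ X <;> simp [m1, m2, hx, hy] at e2 e3 ⊢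
      · have := (e2 hU).2
        omega
      all_goals omega
    obtain ⟨s, s1, s2, s3⟩ := ih (by omega) (by omega) h1' h2'
    refine ⟨fun p q => s p q + if p = x ∧ q = y then 1 else 0, ?_, ?_, ?_⟩
    · intro p hp
      have e1 := s1 p hp
      have e2 : ∑ q ∈ U, (if p = x ∧ q = y then 1 else 0 : ℕ) = if p = x then 1 else 0 := by
        by_cases h : p = x <;> simp [h, hy]
      rw [sum_add_distrib, e2]
      simp only [a'] at e1
      split_ifs at e1 ⊢ with h
      · subst h; omega
      · omega
    · intro q hq
      have e1 := s2 q hq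
      have e2 : ∑ p ∈ U, (if p = x ∧ q = y then 1 else 0 : ℕ) = if q = y then 1 else 0 := by
        by_cases h : q = y <;> simp [h, hx]
      rw [sum_add_distrib, e2]
      simp only [b'] at e1
      split_ifs at e1 ⊢ with h
      · subst h; omega
      · omega
    · convert s3 using 3
      simp only [w']; omega

end Splitting

/-! ### The inductive `(2k+1)`-colouring. -/

section Colouring

variable {V : Type*} [DecidableEq V]

/-- Delete units of weight while possible; a unit from `x` to `y` is undeletable only if it enters a
set of in-degree `k`. -/
theorem WConn.exists_minimal {k : ℕ} {w : V → V → ℕ} {U : Finset V} (h : WConn k w U) :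
    ∃ w₀ : V → V → ℕ, (∀ x y, w₀ x y ≤ w x y) ∧ WConn k w₀ U ∧
      ∀ x ∈ U, ∀ y ∈ U, x ≠ y → w₀ x y ≠ 0 →
        ∃ Y ⊆ U, y ∈ Y ∧ x ∉ Y ∧ wCut w₀ U (U \ Y) = k := by
  induction hn : ∑ x ∈ U, ∑ y ∈ U, w x y using Nat.strong_induction_on generalizing w with
  | _ n ih =>
  by_cases hmin : ∀ x ∈ U, ∀ y ∈ U, x ≠ y → w x y ≠ 0 →
      ∃ Y ⊆ U, y ∈ Y ∧ x ∉ Y ∧ wCut w U (U \ Y) = k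
  · exact ⟨w, fun _ _ => le_rfl, h, hmin⟩
  push Not at hmin
  obtain ⟨x, hx, y, hy, hxy, hw, hno⟩ := hmin
  let w₁ : V → V → ℕ := fun p q => w p q - if p = x ∧ q = y then 1 else 0
  have hw₁ : w = fun p q => w₁ p q + if p = x ∧ q = y then 1 else 0 := by
    funext p q
    simp only [w₁]
    split_ifs with hpq
    · rw [hpq.1, hpq.2]; omega
    · rfl
  have hle : ∀ p q, w₁ p q ≤ w p q := fun p q => Nat.sub_le _ _
  have hlt : ∑ p ∈ U, ∑ q ∈ U, w₁ p q < n := by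
    rw [← hn]
    refine sum_lt_sum (fun p _ => sum_le_sum fun q _ => hle p q) ⟨x, hx, ?_⟩
    refine sum_lt_sum (fun q _ => hle x q) ⟨y, hy, ?_⟩
    simp only [w₁, and_self, if_true]
    omega
  have hconn : WConn k w₁ U := by
    intro X hX hne hU
    have e1 := h X hX hne hU
    have e2 := wCut_add_single w₁ X hx hy
    rw [← hw₁] at e2
    by_cases hc : x ∈ X ∧ y ∉ X
    · have e3 := hno (U \ X) sdiff_subset (mem_sdiff.2 ⟨hy, hc.2⟩)
        (fun hm => (mem_sdiff.1 hm).2 hc.1)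
      rw [Finset.sdiff_sdiff_eq_self hX] at e3
      rw [if_pos hc] at e2
      omega
    · rw [if_neg hc] at e2
      omega
  obtain ⟨w₀, g1, g2, g3⟩ := ih _ hlt hconn rfl
  exact ⟨w₀, fun p q => (g1 p q).trans (hle p q), g2, g3⟩

theorem wCut_insert_of_subset (w : V → V → ℕ) {U X : Finset V} {v : V} (hv : v ∉ U) (hX : X ⊆ U) :
    wCut w (insert v U) X = wCut w U X + ∑ x ∈ X, w x v := by
  have hvX : v ∉ X := fun h => hv (hX h)
  have e : ∑ x ∈ X, w x v = ∑ x ∈ U, if x ∈ X then w x v else 0 := by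
    rw [sum_ite_mem, inter_eq_right.2 hX]
  unfold wCut
  rw [sum_insert hv, e, ← sum_add_distrib]
  simp only [hvX, false_and, if_false, sum_const_zero, zero_add]
  refine sum_congr rfl fun x _ => ?_
  rw [sum_insert hv, add_comm]
  simp [hvX]

theorem wCut_insert_insert (w : V → V → ℕ) {U X : Finset V} {v : V} (hv : v ∉ U) (hX : X ⊆ U) :
    wCut w (insert v U) (insert v X) = wCut w U X + ∑ y ∈ U \ X, w v y := by
  have e : insert v U \ insert v X = U \ X := by
    ext p
    simp only [mem_sdiff, mem_insert]
    by_cases h : p = v <;> simp [h, hv]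
  have e' : wCut w U X = wCut (fun x y => w y x) U (U \ X) := by
    rw [wCut_swap w, Finset.sdiff_sdiff_eq_self hX]
  rw [e', ← wCut_insert_of_subset (fun x y => w y x) hv sdiff_subset, ← e, wCut_swap w,
    Finset.sdiff_sdiff_eq_self (insert_subset_insert v hX)]

/-- Undoing a complete splitting-off at `v`: a `k`-arc-connected part `w'` of the split digraph
together with all arcs at `v` gives a `k`-arc-connected digraph. -/
theorem WConn.unsplit {k : ℕ} {w w' s : V → V → ℕ} {U : Finset V} {v : V} (hv : v ∉ U)
    (ha : ∑ x ∈ U, w x v = k) (hb : ∑ y ∈ U, w v y = k)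
    (sa : ∀ x ∈ U, ∑ y ∈ U, s x y ≤ w x v) (sb : ∀ y ∈ U, ∑ x ∈ U, s x y ≤ w v y)
    (hle : ∀ x y, w' x y ≤ w x y + s x y) (h : WConn k w' U) :
    WConn k (fun x y => if x = v ∨ y = v then w x y else min (w' x y) (w x y)) (insert v U) := by
  set W : V → V → ℕ := fun x y => if x = v ∨ y = v then w x y else min (w' x y) (w x y) with hW
  have W1 : ∀ x, W x v = w x v := fun x => by simp [hW]
  have W2 : ∀ y, W v y = w v y := fun y => by simp [hW]
  have W3 : ∀ x ∈ U, ∀ y ∈ U, w' x y ≤ W x y + s x y := by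
    intro x hx y hy
    have hxv : x ≠ v := fun e => hv (e ▸ hx)
    have hyv : y ≠ v := fun e => hv (e ▸ hy)
    have := hle x y
    simp only [hW, hxv, hyv, or_self, if_false]
    omega
  -- Discarding the split arcs costs a cut at most the split arcs crossing it. Each of these came
  -- from an arc into `v` at its tail and an arc out of `v` at its head, so `s1` or `s2` pays for
  -- the loss, according to the side of `v`.
  have cut_le : ∀ X, wCut w' U X ≤ wCut W U X + wCut s U X := by
    intro X
    unfold wCut
    simp only [← sum_add_distrib]
    refine sum_le_sum fun x hx => sum_le_sum fun y hy => ?_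
    have := W3 x hx y hy
    split_ifs <;> omega
  have s1 : ∀ X ⊆ U, wCut s U X ≤ ∑ x ∈ X, w x v := by
    intro X hX
    have e : ∑ x ∈ X, w x v = ∑ x ∈ U, if x ∈ X then w x v else 0 := by
      rw [sum_ite_mem, inter_eq_right.2 hX]
    rw [e]
    unfold wCut
    refine sum_le_sum fun x hx => ?_
    split_ifs with hxX
    · refine (sum_le_sum fun y _ => ?_).trans (sa x hx)
      split_ifs <;> omega
    · simp [hxX]
  have s2 : ∀ X ⊆ U, wCut s U X ≤ ∑ y ∈ U \ X, w v y := by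
    intro X hX
    have e : ∑ y ∈ U \ X, w v y = ∑ y ∈ U, if y ∈ U \ X then w v y else 0 := by
      rw [sum_ite_mem, inter_eq_right.2 sdiff_subset]
    rw [e]
    unfold wCut
    rw [sum_comm]
    refine sum_le_sum fun y hy => ?_
    split_ifs with hyX
    · refine (sum_le_sum fun x _ => ?_).trans (sb y hy)
      split_ifs <;> omega
    · have : y ∈ X := by simpa [hy] using hyX
      simp [this]
  intro X hX hne hXU
  by_cases hvX : v ∈ X
  · obtain ⟨Y, hvY, rfl⟩ : ∃ Y, v ∉ Y ∧ insert v Y = X :=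
      ⟨X.erase v, notMem_erase v X, insert_erase hvX⟩
    have hY : Y ⊆ U := (insert_subset_insert_iff hvY).1 hX
    rw [wCut_insert_insert W hv hY]
    simp only [W2]
    rcases Y.eq_empty_or_nonempty with rfl | hYne
    · rw [sdiff_empty, hb]
      exact Nat.le_add_left _ _
    · have e1 := h Y hY hYne (fun e => hXU (e ▸ rfl))
      have e2 := cut_le Y
      have e3 := s2 Y hY
      omega
  · have hY : X ⊆ U := (subset_insert_iff_of_notMem hvX).1 hX
    rw [wCut_insert_of_subset W hv hY]
    simp only [W1]
    by_cases hXe : X = U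
    · rw [hXe, ha]
      exact Nat.le_add_left _ _
    · have e1 := h X hY hne hXe
      have e2 := cut_le X
      have e3 := s1 X hY
      omega

theorem card_filter_ne_zero_le {V : Type*} (f : V → ℕ) (U : Finset V) :
    #(U.filter fun x => f x ≠ 0) ≤ ∑ x ∈ U, f x := by
  rw [card_filter]
  refine sum_le_sum fun x _ => ?_
  split_ifs <;> omega

/-- The condition `x ≠ y` on the colouring is needed in the induction: splitting off `x → v → x`
puts weight on the diagonal, which no cut sees. -/
theorem WConn.exists_colouring {k : ℕ} (hk : 1 ≤ k) {w : V → V → ℕ} {U : Finset V}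
    (h : WConn k w U) :
    ∃ w' : V → V → ℕ, (∀ x y, w' x y ≤ w x y) ∧ WConn k w' U ∧
      ∃ c : V → Fin (2 * k + 1), ∀ x ∈ U, ∀ y ∈ U, x ≠ y → w' x y ≠ 0 → c x ≠ c y := by
  induction hn : #U generalizing U w with
  | zero =>
    rw [card_eq_zero] at hn
    subst hn
    exact ⟨w, fun _ _ => le_rfl, h, fun _ => 0, by simp⟩
  | succ n ih =>
    by_cases hU2 : #U < 2
    · refine ⟨w, fun _ _ => le_rfl, h, fun _ => 0, fun x hx y hy hxy => ?_⟩
      exact absurd (card_le_one.1 (by omega) x hx y hy) hxy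
    obtain ⟨w₀, hw₀, h₀, hmin⟩ := h.exists_minimal
    obtain ⟨v, hvU, hin, hout⟩ := exists_balanced hk h₀ (by omega) hmin
    obtain ⟨U', hv, rfl⟩ : ∃ U', v ∉ U' ∧ insert v U' = U :=
      ⟨U.erase v, notMem_erase v U, insert_erase hvU⟩
    have hb : ∑ y ∈ U', w₀ v y = k := by
      have := wCut_insert_insert w₀ hv (empty_subset U')
      rw [sdiff_empty, insert_empty_eq, hout] at this
      simpa [wCut] using this.symm
    have ha : ∑ x ∈ U', w₀ x v = k := by
      have := wCut_insert_of_subset w₀ hv (Subset.refl U')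
      rw [insert_sdiff_of_mem _ (mem_singleton_self v), sdiff_singleton_eq_erase,
        erase_eq_of_notMem hv] at hin
      rw [hin] at this
      refine (Nat.eq_sub_of_add_eq' this.symm).trans ?_
      suffices hz : wCut w₀ U' U' = 0 by rw [hz, Nat.sub_zero]
      unfold wCut
      refine sum_eq_zero fun x _ => sum_eq_zero fun y hy => ?_
      simp [hy]
    have hne : ∀ X ⊆ U', X ≠ insert v U' := fun X hX e => hv (hX (e ▸ mem_insert_self v U'))
    obtain ⟨s, sa, sb, hs⟩ := exists_splitting (k := k) ha hb
      (fun X hX hXne _ => by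
        rw [← wCut_insert_of_subset w₀ hv hX]
        exact h₀ X (hX.trans (subset_insert v U')) hXne (hne X hX))
      (fun X hX hXne hXU => by
        have := wCut_insert_insert w₀ hv (sdiff_subset : U' \ X ⊆ U')
        rw [Finset.sdiff_sdiff_eq_self hX] at this
        rw [← this]
        refine h₀ _ (insert_subset_insert v sdiff_subset) (insert_nonempty _ _) fun e => ?_
        obtain ⟨x, hx⟩ := hXne
        have hx' : x ∈ insert v (U' \ X) := e ▸ mem_insert_of_mem (hX hx)
        rcases mem_insert.1 hx' with rfl | hx'
        · exact hv (hX hx)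
        · exact (mem_sdiff.1 hx').2 hx)
    obtain ⟨w', hw', hconn, c, hc⟩ := ih hs (by rw [card_insert_of_notMem hv] at hn; omega)
    refine ⟨_, ?_, hconn.unsplit hv ha hb sa sb hw', ?_⟩
    · intro x y
      split_ifs
      · exact hw₀ x y
      · exact (min_le_right _ _).trans (hw₀ x y)
    · let N := (U'.filter fun x => w₀ x v ≠ 0) ∪ (U'.filter fun x => w₀ v x ≠ 0)
      have hN : #(N.image c) < 2 * k + 1 := by
        have e1 := card_filter_ne_zero_le (fun x => w₀ x v) U'
        have e2 := card_filter_ne_zero_le (fun x => w₀ v x) U'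
        have e3 : #(N.image c) ≤ _ := card_image_le.trans (card_union_le _ _)
        omega
      obtain ⟨d, -, hd⟩ := exists_mem_notMem_of_card_lt_card
        (s := N.image c) (t := univ) (by simpa using hN)
      have hd' : ∀ x ∈ U', (w₀ x v ≠ 0 ∨ w₀ v x ≠ 0) → c x ≠ d := by
        rintro x hx hxv rfl
        refine hd (mem_image_of_mem c ?_)
        rcases hxv with hxv | hxv
        · exact mem_union_left _ (mem_filter.2 ⟨hx, hxv⟩)
        · exact mem_union_right _ (mem_filter.2 ⟨hx, hxv⟩)
      refine ⟨Function.update c v d, fun x hx y hy hxy hwxy => ?_⟩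
      by_cases hxv : x = v
      · subst hxv
        have hy' := (mem_insert.1 hy).resolve_left hxy.symm
        rw [Function.update_self, Function.update_of_ne hxy.symm]
        exact (hd' y hy' (Or.inr (by simpa using hwxy))).symm
      · by_cases hyv : y = v
        · subst hyv
          have hx' := (mem_insert.1 hx).resolve_left hxy
          rw [Function.update_self, Function.update_of_ne hxy]
          exact hd' x hx' (Or.inl (by simpa using hwxy))
        · rw [Function.update_of_ne hxv, Function.update_of_ne hyv]
          refine hc x ((mem_insert.1 hx).resolve_left hxv) y ((mem_insert.1 hy).resolve_left hyv)
            hxy fun e => hwxy ?_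
          simp [hxv, hyv, e]

end Colouring

/-! ### From weights back to digraphs. -/

namespace MultiDigraph

variable {V A : Type*}

open Classical in
/-- The number of arcs from `x` to `y`. -/
noncomputable def mult [Fintype A] (D : MultiDigraph V A) (x y : V) : ℕ :=
  #{a : A | D.tail a = x ∧ D.head a = y}

open Classical in
theorem wCut_mult [Fintype V] [Fintype A] (D : MultiDigraph V A) (X : Finset V) :
    wCut D.mult univ X = #{a : A | D.tail a ∈ X ∧ D.head a ∉ X} := by
  rw [card_eq_sum_card_fiberwise (f := fun a => (D.tail a, D.head a)) (t := univ)
    (fun _ _ => mem_coe.2 (mem_univ _)), Fintype.sum_prod_type]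
  unfold wCut mult
  refine sum_congr rfl fun x _ => sum_congr rfl fun y _ => ?_
  rw [filter_filter]
  split_ifs with h
  · congr 1
    ext a
    simp only [mem_filter, mem_univ, true_and, Prod.mk.injEq]
    constructor
    · rintro ⟨rfl, rfl⟩; exact ⟨h, rfl, rfl⟩
    · exact fun h => h.2
  · symm
    rw [card_eq_zero, filter_eq_empty_iff]
    rintro a - ⟨h1, h2⟩
    simp only [Prod.mk.injEq] at h2
    exact h (h2.1 ▸ h2.2 ▸ h1)

open Classical in
theorem arcConnected_iff_wConn [Fintype V] [Fintype A] (D : MultiDigraph V A) {k : ℕ} :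
    D.ArcConnected k ↔ WConn k D.mult univ := by
  rw [arcConnected_iff]
  unfold WConn
  simp only [wCut_mult, subset_univ, true_implies]

open Classical in
theorem mult_spanningSub [Fintype A] (D : MultiDigraph V A) (S : Set A) [Fintype S] (x y : V) :
    (D.spanningSub S).mult x y = #{a : A | a ∈ S ∧ D.tail a = x ∧ D.head a = y} := by
  refine card_bij (fun a _ => a.1) ?_ (fun _ _ _ _ h => Subtype.ext h) ?_
  · intro a ha
    exact mem_filter.2 ⟨mem_univ _, a.2, (mem_filter.1 ha).2⟩
  · intro a ha
    have h := (mem_filter.1 ha).2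
    exact ⟨⟨a, h.1⟩, mem_filter.2 ⟨mem_univ _, h.2⟩, rfl⟩

open Classical in
theorem exists_spanningSub_mult [Fintype A] (D : MultiDigraph V A) {w : V → V → ℕ}
    (hw : ∀ x y, w x y ≤ D.mult x y) :
    ∃ S : Set A, ∀ x y, (D.spanningSub S).mult x y = w x y := by
  choose f hf hcard using fun x y => exists_subset_card_eq (hw x y)
  obtain ⟨S, hS⟩ : ∃ S : Set A, ∀ a, a ∈ S ↔ a ∈ f (D.tail a) (D.head a) :=
    ⟨{a | a ∈ f (D.tail a) (D.head a)}, fun _ => Iff.rfl⟩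
  refine ⟨S, fun x y => ?_⟩
  rw [← hcard x y, mult_spanningSub]
  congr 1
  ext a
  rw [mem_filter, hS]
  constructor
  · rintro ⟨-, h, rfl, rfl⟩
    exact h
  · intro h
    obtain ⟨rfl, rfl⟩ := (mem_filter.1 (hf x y h)).2
    exact ⟨mem_univ _, h, rfl, rfl⟩

theorem ArcConnected.exists_partite {k : ℕ} (hk : 1 ≤ k) [Finite V] [Finite A]
    {D : MultiDigraph V A} (h : D.ArcConnected k) :
    ∃ S : Set A, (D.spanningSub S).ArcConnected k ∧
      (D.spanningSub S).IsPartite (2 * k + 1) := by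
  classical
  cases nonempty_fintype V
  cases nonempty_fintype A
  obtain ⟨w, hw, hconn, c, hc⟩ := (D.arcConnected_iff_wConn.1 h).exists_colouring hk
  obtain ⟨S, hS⟩ := D.exists_spanningSub_mult hw
  refine ⟨S, ?_, c, fun a => ?_⟩
  · rw [arcConnected_iff_wConn]
    rwa [show (D.spanningSub S).mult = w from funext₂ hS]
  · refine hc _ (mem_univ _) _ (mem_univ _) ((D.spanningSub S).loopless a) ?_
    rw [← hS, mult]
    exact (card_pos.2 ⟨a, by simp⟩).ne'

end MultiDigraph

/-! ### The extremal digraphs `D_{k,r}`. -/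

namespace MultiDigraph

/-- Jump ahead by `k - 1` from a position in `p` until `p` fails; once `x + 1 + n` is within reach,
jump there. The residue modulo `k - 1` survives, so different starting residues give different
tails. -/
theorem exists_jump {p : ℕ → Prop} {n k x z : ℕ} (hk : 2 ≤ k) (hy : ¬p (x + 1 + n))
    (hz : z + 2 ≤ n) (hp : p (x + 1 + z)) :
    ∃ z' s, z ≤ z' ∧ z' + 2 ≤ n ∧ z' ≡ z [MOD k - 1] ∧ s < k ∧ p (x + 1 + z') ∧
      ¬p (x + 1 + z' + s + 1) := by
  induction hm : n - z using Nat.strong_induction_on generalizing z with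
  | _ m ih =>
  by_cases h1 : z + (k - 1) + 2 ≤ n
  · by_cases h2 : p (x + 1 + (z + (k - 1)))
    · obtain ⟨z', s, g1, g2, g3, g4⟩ := ih _ (by omega) h1 h2 rfl
      exact ⟨z', s, by omega, g2, g3.trans (by simp [Nat.ModEq]), g4⟩
    · refine ⟨z, k - 2, le_rfl, hz, Nat.ModEq.refl z, by omega, hp, ?_⟩
      rwa [show x + 1 + z + (k - 2) + 1 = x + 1 + (z + (k - 1)) by omega]
  · refine ⟨z, n - z - 1, le_rfl, hz, Nat.ModEq.refl z, by omega, hp, ?_⟩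
    rwa [show x + 1 + z + (n - z - 1) + 1 = x + 1 + n by omega]

theorem le_card_leaving_cyclePower {n k : ℕ} (h : k < n) {X : Finset (Fin n)}
    (hne : X.Nonempty) (hX : X ≠ univ) :
    k ≤ #{e : Fin n × Fin k | (cyclePower n k h).tail e ∈ X ∧ (cyclePower n k h).head e ∉ X} := by
  have hn : 0 < n := by omega
  let p : ℕ → Prop := fun m => (⟨m % n, Nat.mod_lt _ hn⟩ : Fin n) ∈ X
  have hper : ∀ m, p (m + n) ↔ p m := by
    intro m
    simp only [p, Nat.add_mod_right]
  have hval : ∀ y : Fin n, p y ↔ y ∈ X := by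
    intro y
    simp only [p, Nat.mod_eq_of_lt y.2]
  obtain ⟨x, hx, hx1⟩ : ∃ x, p x ∧ ¬p (x + 1) := by
    by_contra! hc
    obtain ⟨u, hu⟩ := hne
    refine hX (eq_univ_iff_forall.2 fun y => ?_)
    have hall : ∀ m, p (u + m) := by
      intro m
      induction m with
      | zero => exact (hval u).2 hu
      | succ m ih => exact hc _ ih
    have := hall (y + (n - u))
    rwa [show (u : ℕ) + (y + (n - u)) = y + n by omega, hper, hval] at this
  -- This traces `k` arc-disjoint routes from `x ∈ X` around the cycle to `x + 1 ∉ X`, each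
  -- beginning with the arc to `x + 1 + t`, and picks an arc leaving `X` on each. Offset `z = n - 1`
  -- is `x` itself; later tails are told apart by `t` modulo `k - 1`, where `1 ≤ t < k`.
  have key : ∀ t : Fin k, ∃ z s, z < n ∧ s < k ∧ p (x + 1 + z) ∧ ¬p (x + 1 + z + s + 1) ∧
      ((z + 1 = n ∧ s = t) ∨ (z + 2 ≤ n ∧ 1 ≤ (t : ℕ) ∧ z ≡ t [MOD k - 1])) := by
    intro t
    by_cases ht : 1 ≤ (t : ℕ) ∧ p (x + 1 + t)
    · obtain ⟨z, s, g1, g2, g3, g4, g5, g6⟩ := exists_jump (p := p) (n := n) (k := k) (by omega)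
        (by rwa [hper]) (by omega) ht.2
      exact ⟨z, s, by omega, g4, g5, g6, Or.inr ⟨g2, ht.1, g3⟩⟩
    · refine ⟨n - 1, t, by omega, t.2, ?_, ?_, Or.inl ⟨by omega, rfl⟩⟩
      · rwa [show x + 1 + (n - 1) = x + n by omega, hper]
      · rw [show x + 1 + (n - 1) + t + 1 = x + 1 + t + n by omega, hper]
        intro hc
        refine ht ⟨?_, hc⟩
        by_contra h0
        rw [show (t : ℕ) = 0 by omega] at hc
        exact hx1 hc
  choose z s hz hs hp hp' hzs using key
  have hinj : Function.Injective fun t : Fin k =>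
      ((⟨(x + 1 + z t) % n, Nat.mod_lt _ hn⟩, ⟨s t, hs t⟩) : Fin n × Fin k) := by
    intro t t' he
    simp only [Prod.mk.injEq, Fin.mk.injEq] at he
    have hzz : z t = z t' :=
      Nat.ModEq.eq_of_lt_of_lt (Nat.ModEq.add_left_cancel' (x + 1) he.1) (hz t) (hz t')
    rcases hzs t with ⟨a1, a2⟩ | ⟨a1, a2, a3⟩ <;> rcases hzs t' with ⟨b1, b2⟩ | ⟨b1, b2, b3⟩
    · exact Fin.ext (by omega)
    · omega
    · omega
    · rw [hzz] at a3
      have e := a3.symm.trans b3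
      have e' : (t : ℕ) - 1 ≡ t' - 1 [MOD k - 1] := by
        refine Nat.ModEq.add_right_cancel' 1 ?_
        rwa [Nat.sub_add_cancel a2, Nat.sub_add_cancel b2]
      have := Nat.ModEq.eq_of_lt_of_lt e' (by omega) (by omega)
      exact Fin.ext (by omega)
  have := card_le_card_of_injOn (s := univ) (t := univ.filter fun e : Fin n × Fin k =>
    (cyclePower n k h).tail e ∈ X ∧ (cyclePower n k h).head e ∉ X) _ ?_ hinj.injOn
  · simpa using this
  · intro t _
    refine mem_coe.2 (mem_filter.2 ⟨mem_univ _, hp t, ?_⟩)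
    have e : ((x + 1 + z t) % n + s t + 1) % n = (x + 1 + z t + s t + 1) % n :=
      (((Nat.mod_modEq _ n).add_right (s t)).add_right 1)
    have := hp' t
    simp only [p, ← e] at this
    exact this

theorem joinedRotative_arcConnected {k r : ℕ} (hr : k + 1 ≤ r) :
    (joinedRotative k r hr).ArcConnected k := by
  classical
  rw [arcConnected_iff]
  intro X hne hX
  -- Either `X` cuts some copy of the tournament, or it is a union of copies and cuts the cycle
  -- power on the vertices `(i, 0)`.
  by_cases hi : ∃ i j j', (i, j) ∈ X ∧ (i, j') ∉ X
  · obtain ⟨i, j, j', hj, hj'⟩ := hi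
    have h1 := le_card_leaving_cyclePower (show k < 2 * k + 1 by omega)
      (X := univ.filter fun j => (i, j) ∈ X) ⟨j, by simpa using hj⟩
      (fun e => hj' (by simpa using (eq_univ_iff_forall.1 e) j'))
    refine h1.trans (card_le_card_of_injOn (fun e => Sum.inl (i, e)) ?_ ?_)
    · intro e he
      simp only [coe_filter, mem_filter, mem_univ, true_and] at he ⊢
      exact he
    · intro e _ e' _ h
      simpa using h
  · push Not at hi
    have h1 := le_card_leaving_cyclePower (show k < r by omega)
      (X := univ.filter fun i => (i, 0) ∈ X) ?_ ?_
    · refine h1.trans (card_le_card_of_injOn (fun e => Sum.inr e) ?_ ?_)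
      · intro e he
        simp only [coe_filter, mem_filter, mem_univ, true_and] at he ⊢
        exact he
      · intro e _ e' _ h
        simpa using h
    · obtain ⟨⟨i, j⟩, hj⟩ := hne
      exact ⟨i, by simpa using hi i j 0 hj⟩
    · intro e
      refine hX (eq_univ_iff_forall.2 fun ⟨i, j⟩ => ?_)
      exact hi i 0 j (by simpa using (eq_univ_iff_forall.1 e) i)

open Classical in
theorem le_card_leaving_of_spanningSub {V A : Type*} [Fintype V] [Fintype A]
    {D : MultiDigraph V A} {S : Set A} {k : ℕ} (h : (D.spanningSub S).ArcConnected k)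
    {X : Finset V} (hne : X.Nonempty) (hX : X ≠ univ) :
    k ≤ #{a : A | a ∈ S ∧ D.tail a ∈ X ∧ D.head a ∉ X} := by
  refine ((D.spanningSub S).arcConnected_iff.1 h X hne hX).trans
    (card_le_card_of_injOn Subtype.val ?_ Subtype.val_injective.injOn)
  intro a ha
  have := (mem_filter.1 (mem_coe.1 ha)).2
  exact mem_coe.2 (mem_filter.2 ⟨mem_univ _, a.2, this⟩)

/-- If the arcs leaving `X` are distinguished by `k` labels, all of them lie in each spanning
`k`-arc-connected subdigraph. -/
theorem mem_of_leaving {V A : Type*} [Finite V] [Finite A]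
    {D : MultiDigraph V A} {S : Set A} {k : ℕ} (h : (D.spanningSub S).ArcConnected k)
    {X : Set V} (f : A → Fin k)
    (hf : Set.InjOn f {a | D.tail a ∈ X ∧ D.head a ∉ X}) {a : A}
    (ha : D.tail a ∈ X) (ha' : D.head a ∉ X) : a ∈ S := by
  classical
  cases nonempty_fintype V
  cases nonempty_fintype A
  by_contra haS
  have h1 := le_card_leaving_of_spanningSub h (X := univ.filter (· ∈ X))
    ⟨D.tail a, by simpa using ha⟩
    (fun e => ha' (by simpa using (eq_univ_iff_forall.1 e) (D.head a)))
  simp only [mem_filter, mem_univ, true_and] at h1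
  have h2 := card_le_card_of_injOn (t := univ)
    (s := insert a (univ.filter fun a => a ∈ S ∧ D.tail a ∈ X ∧ D.head a ∉ X)) f
    (fun _ _ => mem_coe.2 (mem_univ _)) (hf.mono fun b hb => ?_)
  · rw [card_insert_of_notMem (by simp [haS]), card_univ, Fintype.card_fin] at h2
    omega
  · rcases mem_insert.1 (mem_coe.1 hb) with rfl | hb
    · exact ⟨ha, ha'⟩
    · exact (mem_filter.1 hb).2.2

/-- Some end of the arc has second coordinate nonzero, and only `k` arcs enter and `k` leave that
vertex. The label `f` is the step length, which distinguishes arcs with a common head or a common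
tail. -/
theorem inl_mem_of_spanningSub {k r : ℕ} (hr : k + 1 ≤ r) {S}
    (h : ((joinedRotative k r hr).spanningSub S).ArcConnected k) (i : Fin r)
    (e : Fin (2 * k + 1) × Fin k) : Sum.inl (i, e) ∈ S := by
  let f : (Fin r × (Fin (2 * k + 1) × Fin k)) ⊕ (Fin r × Fin k) → Fin k :=
    Sum.elim (fun a => a.2.2) (fun a => a.2)
  by_cases h0 : (rotativeTournament k).tail e = 0
  · have h1 : (rotativeTournament k).head e ≠ 0 := fun h2 =>
      (rotativeTournament k).loopless e (h0.trans h2.symm)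
    refine mem_of_leaving h (X := {(i, (rotativeTournament k).head e)}ᶜ) f ?_ ?_ ?_
    · have hform : ∀ a, (joinedRotative k r hr).head a = (i, (rotativeTournament k).head e) →
          ∃ e', a = Sum.inl (i, e') ∧
            (rotativeTournament k).head e' = (rotativeTournament k).head e := by
        rintro (⟨i', e'⟩ | e') ha
        · obtain ⟨rfl, h3⟩ := Prod.mk.inj ha
          exact ⟨e', rfl, h3⟩
        · exact absurd (Prod.mk.inj ha).2.symm h1
      rintro a ⟨-, ha⟩ b ⟨-, hb⟩ hab
      obtain ⟨a, rfl, ha'⟩ := hform a (by simpa using ha)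
      obtain ⟨b, rfl, hb'⟩ := hform b (by simpa using hb)
      have h2 : a.2 = b.2 := hab
      have h3 := ha'.trans hb'.symm
      simp only [rotativeTournament, cyclePower, Fin.mk.injEq, h2] at h3
      have h4 : (a.1 : ℕ) = b.1 := by
        refine Nat.ModEq.eq_of_lt_of_lt (m := 2 * k + 1) ?_ a.1.2 b.1.2
        exact Nat.ModEq.add_right_cancel' (b.2 : ℕ) (Nat.ModEq.add_right_cancel' 1 h3)
      rw [show a = b from Prod.ext (Fin.ext h4) h2]
    · intro he
      exact (rotativeTournament k).loopless e (Prod.mk.inj he).2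
    · exact fun hc => hc rfl
  · refine mem_of_leaving h (X := {(i, (rotativeTournament k).tail e)}) f ?_ rfl ?_
    · have hform : ∀ a, (joinedRotative k r hr).tail a = (i, (rotativeTournament k).tail e) →
          ∃ e', a = Sum.inl (i, e') ∧ e'.1 = e.1 := by
        rintro (⟨i', e'⟩ | e') ha
        · obtain ⟨rfl, h3⟩ := Prod.mk.inj ha
          exact ⟨e', rfl, h3⟩
        · exact absurd (Prod.mk.inj ha).2.symm h0
      rintro a ⟨ha, -⟩ b ⟨hb, -⟩ hab
      obtain ⟨a, rfl, ha'⟩ := hform a ha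
      obtain ⟨b, rfl, hb'⟩ := hform b hb
      rw [show a = b from Prod.ext (ha'.trans hb'.symm) hab]
    · intro he
      exact (rotativeTournament k).loopless e (Prod.mk.inj he).2.symm

/-- The underlying graph of the rotative tournament is complete. -/
theorem rotativeTournament_adj (k : ℕ) {j j' : Fin (2 * k + 1)} (h : j < j') :
    ∃ e, ((rotativeTournament k).tail e = j ∧ (rotativeTournament k).head e = j') ∨
      ((rotativeTournament k).tail e = j' ∧ (rotativeTournament k).head e = j) := by
  have hlt : (j : ℕ) < j' := h
  by_cases hd : (j' : ℕ) - j ≤ k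
  · refine ⟨(j, ⟨j' - j - 1, by omega⟩), Or.inl ⟨rfl, Fin.ext ?_⟩⟩
    simp only [rotativeTournament, cyclePower]
    rw [show (j : ℕ) + (j' - j - 1) + 1 = j' by omega, Nat.mod_eq_of_lt j'.2]
  · refine ⟨(j', ⟨2 * k - (j' - j), by omega⟩), Or.inr ⟨rfl, Fin.ext ?_⟩⟩
    simp only [rotativeTournament, cyclePower]
    rw [show (j' : ℕ) + (2 * k - (j' - j)) + 1 = j + (2 * k + 1) by omega, Nat.add_mod_right,
      Nat.mod_eq_of_lt j.2]

theorem le_of_isPartite_spanningSub {k r m : ℕ} (hr : k + 1 ≤ r) {S}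
    (h : ((joinedRotative k r hr).spanningSub S).ArcConnected k)
    (hm : ((joinedRotative k r hr).spanningSub S).IsPartite m) : 2 * k + 1 ≤ m := by
  obtain ⟨c, hc⟩ := hm
  let i : Fin r := ⟨0, by omega⟩
  have hlt : ∀ j j' : Fin (2 * k + 1), j < j' → c (i, j) ≠ c (i, j') := by
    intro j j' hj
    obtain ⟨e, ⟨rfl, rfl⟩ | ⟨rfl, rfl⟩⟩ := rotativeTournament_adj k hj
    · exact hc ⟨_, inl_mem_of_spanningSub hr h i e⟩
    · exact (hc ⟨_, inl_mem_of_spanningSub hr h i e⟩).symm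
  have hinj : Function.Injective fun j : Fin (2 * k + 1) => c (i, j) := by
    intro j j' he
    rcases lt_trichotomy j j' with hj | hj | hj
    · exact absurd he (hlt _ _ hj)
    · exact hj
    · exact absurd he.symm (hlt _ _ hj)
  simpa using Fintype.card_le_of_injective _ hinj

theorem exists_isPartite {V A : Type*} [Finite V] (D : MultiDigraph V A) :
    ∃ m, D.IsPartite m := by
  cases nonempty_fintype V
  exact ⟨_, Fintype.equivFin V, fun a h => D.loopless a ((Fintype.equivFin V).injective h)⟩

end MultiDigraph

end

theorem theorem5p4 :
    -- every `k`-arc-connected digraph has a spanning `k`-arc-connected `(2k+1)`-partite subdigraph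
    (∀ k : ℕ, 1 ≤ k → ∀ (V : Type*) (A : Type*) [Finite V] [Finite A] (D : MultiDigraph V A),
      D.ArcConnected k →
        ∃ S : Set A, (D.spanningSub S).ArcConnected k ∧
          (D.spanningSub S).IsPartite (2 * k + 1)) ∧
    -- the digraphs `D_{k,r}` are extremal
    (∀ (k r : ℕ) (_ : 1 ≤ k) (hr : k + 1 ≤ r),
      (MultiDigraph.joinedRotative k r hr).ArcConnected k ∧
        ∀ S, ((MultiDigraph.joinedRotative k r hr).spanningSub S).ArcConnected k →
          2 * k + 1 ≤ ((MultiDigraph.joinedRotative k r hr).spanningSub S).chromaticNumber) ∧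
    -- hence, for each `k`, infinitely many (arbitrarily large) digraphs show optimality
    (∀ k : ℕ, 1 ≤ k → ∀ N : ℕ, ∃ (V : Type) (A : Type) (_ : Finite V) (_ : Finite A)
      (D : MultiDigraph V A), N ≤ Nat.card V ∧ D.ArcConnected k ∧
        ¬ ∃ S : Set A, (D.spanningSub S).ArcConnected k ∧
          (D.spanningSub S).IsPartite (2 * k)) := by
  refine ⟨fun k hk V A _ _ D h => h.exists_partite hk, fun k r _ hr => ?_, fun k hk N => ?_⟩
  · exact ⟨MultiDigraph.joinedRotative_arcConnected hr, fun S hS =>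
      -- Some `m` must be known to work, since `sInf ∅ = 0` in `ℕ`.
      le_csInf (MultiDigraph.exists_isPartite _) fun m hm =>
        MultiDigraph.le_of_isPartite_spanningSub hr hS hm⟩
  · have hr : k + 1 ≤ k + 1 + N := Nat.le_add_right _ _
    refine ⟨_, _, inferInstance, inferInstance, MultiDigraph.joinedRotative k _ hr, ?_,
      MultiDigraph.joinedRotative_arcConnected hr, ?_⟩
    · rw [Nat.card_prod, Nat.card_fin, Nat.card_fin]
      nlinarith
    · rintro ⟨S, hS, hp⟩
      have := MultiDigraph.le_of_isPartite_spanningSub hr hS hp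
      omega
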